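/- **Setting.** Let $\Sigma$ be a finite ranked signature, and let $X\notin\Sigma$. A context is a tree over $\Sigma\cup\{X\}$ with exactly one occurrence of the hole $X$; $C[t]$ and $C[D]$ denote the substitution of a tree $t$ or a context $D$ for the hole. Constants have height $1$, $\mathrm{ht}(X)=0$, and a symbol with its children has height one more than the maximal height of the children. Tokens are $a,b,c,d,\bar a,\bar b,\bar c,\bar d,\langle,\rangle$. Each constant of $\Sigma$ carries a token or the empty word, and the projective yield $\mathrm{yd}(t)$ is the left-to-right concatenation of the words at the leaves of $t$; for a context, $\mathrm{yd}(C)$ is the word generated to the left of the hole followed by the word generated to its right. $|w|_z$ is the number of occurrences of $z$ in $w$. Let $G$ be a linear monadic context-free tree grammar over $\Sigma$: it has finitely many nonterminals, of rank $0$ or $1$, a start symbol of rank $0$, and finitely many rules $A\to r$ ($A$ of rank $0$, $r$ a tree over terminals and nonterminals) and $A(X)\to R$ ($A$ of rank $1$, $R$ a context over terminals and nonterminals). Let $\mathbf T=L(G)$ be the set of trees over $\Sigma$ that are derived from the start symbol by rewriting. Let $\mathsf{HR}_k$ be the HR algebra of finite directed edge-labelled multigraphs with at most $k$ named sources (constants,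 parallel composition, renaming and forgetting of sources), let $h$ be a tree homomorphism from trees over $\Sigma$ to terms over $\mathsf{HR}_k$, and let $$\mathcal{REL}=\mathcal{REL}((G,\mathrm{yd}),h,\mathsf{HR}_k)=\{\langle \mathrm{yd}(t),[\![h(t)]\!]\rangle : t\in\mathbf T\}$$ (graphs up to isomorphism). Let $\mathsf{CSD}_s=\bigcup_{m,n\ge 1}A^mB^nC^mD^n$, where $A=\{a\,\langle^i\bar a^i\rangle^i : i\ge 0\}$, and $B,C,D$ are defined likewise from $b,c,d$. Let $\mathsf{Sep}=\{a/c,\;c/a,\;b/d,\;d/b\}$. A tree $t$ is *$x,y,l$-separated* if $t=D_x[D_0[t_y]]$ for some contexts $D_x,D_0$ and some tree $t_y$ with $|\mathrm{yd}(D_x)|_y=0$, $|\mathrm{yd}(D_0)|_x\le l$ and $|\mathrm{yd}(t_y)|_x=0$. A number $p\in\mathbb N_0$ is a *pumping height* of $\mathbf T$ if every $t\in\mathbf T$ with $\mathrm{ht}(t)>p$ can be written $t=C_1[C_2[C_3[C_4[t_5]]]]$ with $\mathrm{ht}(C_2[C_3[C_4]])\le p$, $\mathrm{ht}(C_2)+\mathrm{ht}(C_4)>0$,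 and $C_1[v^i[t_5]]\in\mathbf T$ for all $i\ge 0$, where $v^0=C_3$ and $v^{i+1}=C_2[v^i[C_4]]$. **Statement.** Suppose that the set of strings occurring in $\mathcal{REL}$ is $\mathsf{CSD}_s$ (this holds in particular if $\mathcal{REL}$ equals the relation $\mathsf{CSD}$, which pairs the strings of $\mathsf{CSD}_s$ with graphs). Then $\mathbf T$ has a pumping height. Moreover, for every pumping height $p$ of $\mathbf T$ there is a maximal number $l_0$ of string tokens or of edges that a context of height at most $p$ generates under $\mathrm{yd}$ and $h$ (the larger of the two maxima), and with this $l_0$, every $t\in\mathbf T$ is $x,y,l_0$-separated for some $x/y\in\mathsf{Sep}$. -/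

import Mathlib

namespace CrossSerial

/-! Ranked trees and one-hole contexts -/

/-- A ranked signature: symbols, each with a rank. -/
structure Signature where
  Sym : Type
  rank : Sym → ℕ

/-- Trees over a ranked signature (a symbol of rank `0` applied to nothing is a constant). -/
inductive Tree (S : Signature) : Type
  | node (f : S.Sym) (ts : Fin (S.rank f) → Tree S) : Tree S

/-- Contexts: trees with exactly one occurrence of the hole `X`.  `node f i ts C` has the
context `C` as its child number `i` and the trees `ts j` as its other children. -/
inductive Ctx (S : Signature) : Type
  | hole : Ctx S
  | node (f : S.Sym) (i : Fin (S.rank f)) (ts : {j : Fin (S.rank f) // j ≠ i} → Tree S)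
      (C : Ctx S) : Ctx S

/-- Height of a tree; constants have height `1`. -/
def Tree.height {S : Signature} : Tree S → ℕ
  | .node _ ts => 1 + Finset.univ.sup fun j => (ts j).height

/-- Height of a context; the hole has height `0`. -/
def Ctx.height {S : Signature} : Ctx S → ℕ
  | .hole => 0
  | .node _ _ ts C => 1 + max (Finset.univ.sup fun j => (ts j).height) C.height

/-- `C.fill t` is the tree `C[t]`. -/
def Ctx.fill {S : Signature} : Ctx S → Tree S → Tree S
  | .hole, t => t
  | .node f i ts C, t => .node f fun j => if hj : j = i then C.fill t else ts ⟨j, hj⟩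

/-- `C.comp D` is the context `C[D]`. -/
def Ctx.comp {S : Signature} : Ctx S → Ctx S → Ctx S
  | .hole, D => D
  | .node f i ts C, D => .node f i ts (C.comp D)

/-! Projective yield.  The function `lex` gives the token carried by a constant (`none` stands
for the empty word); its values at symbols of positive rank are irrelevant. -/

/-- The left-to-right concatenation of the tokens at the leaves of a tree. -/
def Tree.yield {S : Signature} {W : Type} (lex : S.Sym → Option W) : Tree S → List W
  | .node f ts =>
      if S.rank f = 0 then (lex f).toList
      else (List.finRange (S.rank f)).flatMap fun j => (ts j).yield lex

/-- The string generated by a context to the left of its hole. -/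
def Ctx.left {S : Signature} {W : Type} (lex : S.Sym → Option W) : Ctx S → List W
  | .hole => []
  | .node f i ts C =>
      ((List.finRange (S.rank f)).flatMap fun j =>
        if hj : j < i then (ts ⟨j, ne_of_lt hj⟩).yield lex else []) ++ C.left lex

/-- The string generated by a context to the right of its hole. -/
def Ctx.right {S : Signature} {W : Type} (lex : S.Sym → Option W) : Ctx S → List W
  | .hole => []
  | .node f i ts C =>
      C.right lex ++ ((List.finRange (S.rank f)).flatMap fun j =>
        if hj : i < j then (ts ⟨j, ne_of_gt hj⟩).yield lex else [])

/-- The yield of a context. -/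
def Ctx.yield {S : Signature} {W : Type} (lex : S.Sym → Option W) (C : Ctx S) : List W :=
  C.left lex ++ C.right lex

/-! Linear monadic context-free tree grammars -/

/-- The signature of terminals and of nonterminals of rank `0` (in `N₀`) and `1` (in `N₁`). -/
def Signature.extend (S : Signature) (N₀ N₁ : Type) : Signature where
  Sym := (N₀ ⊕ N₁) ⊕ S.Sym
  rank := Sum.elim (Sum.elim (fun _ => 0) (fun _ => 1)) S.rank

/-- A linear monadic context-free tree grammar with terminal signature `S`: nonterminals of rank
zero rewrite to trees, nonterminals of rank one rewrite to contexts. -/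
structure LMCFTG (S : Signature) where
  N₀ : Type
  N₁ : Type
  finite_N₀ : Finite N₀
  finite_N₁ : Finite N₁
  start : N₀
  rules₀ : Set (N₀ × Tree (S.extend N₀ N₁))
  rules₁ : Set (N₁ × Ctx (S.extend N₀ N₁))
  finite_rules₀ : rules₀.Finite
  finite_rules₁ : rules₁.Finite

/-- A terminal tree, seen as a sentential form. -/
def Tree.lift {S : Signature} (N₀ N₁ : Type) : Tree S → Tree (S.extend N₀ N₁)
  | .node f ts => .node (S := S.extend N₀ N₁) (Sum.inr f) fun j => (ts j).lift N₀ N₁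

/-- The sentential form consisting of a nonterminal of rank zero. -/
def Tree.nt₀ (S : Signature) {N₀ : Type} (N₁ : Type) (A : N₀) : Tree (S.extend N₀ N₁) :=
  .node (S := S.extend N₀ N₁) (Sum.inl (Sum.inl A)) Fin.elim0

/-- The sentential form `A(s)` for a nonterminal `A` of rank one. -/
def Tree.nt₁ {S : Signature} {N₀ N₁ : Type} (A : N₁) (s : Tree (S.extend N₀ N₁)) :
    Tree (S.extend N₀ N₁) :=
  .node (S := S.extend N₀ N₁) (Sum.inl (Sum.inr A)) fun _ => s

/-- One rewriting step, at an arbitrary position. -/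
inductive LMCFTG.Step {S : Signature} (G : LMCFTG S) :
    Tree (S.extend G.N₀ G.N₁) → Tree (S.extend G.N₀ G.N₁) → Prop
  | expand₀ (K : Ctx (S.extend G.N₀ G.N₁)) (A : G.N₀) (r : Tree (S.extend G.N₀ G.N₁))
      (hr : (A, r) ∈ G.rules₀) : G.Step (K.fill (Tree.nt₀ S G.N₁ A)) (K.fill r)
  | expand₁ (K : Ctx (S.extend G.N₀ G.N₁)) (A : G.N₁) (R : Ctx (S.extend G.N₀ G.N₁))
      (hR : (A, R) ∈ G.rules₁) (s : Tree (S.extend G.N₀ G.N₁)) :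
      G.Step (K.fill (Tree.nt₁ A s)) (K.fill (R.fill s))

/-- The tree language generated by the grammar. -/
def LMCFTG.language {S : Signature} (G : LMCFTG S) : Set (Tree S) :=
  {t | Relation.ReflTransGen G.Step (Tree.nt₀ S G.N₁ G.start) (t.lift G.N₀ G.N₁)}

/-! Pumping -/

/-- The iterated contexts `v⁰ = C₃`, `vⁱ⁺¹ = C₂[vⁱ[C₄]]`. -/
def pump {S : Signature} (C₂ C₃ C₄ : Ctx S) : ℕ → Ctx S
  | 0 => C₃
  | i + 1 => C₂.comp ((pump C₂ C₃ C₄ i).comp C₄)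

/-- `(C₁, C₂, C₃, C₄, t₅)` is a pumping decomposition of `t` with respect to the height `p`. -/
def IsPumpingDecomposition {S : Signature} (T : Set (Tree S)) (p : ℕ) (t : Tree S)
    (C₁ C₂ C₃ C₄ : Ctx S) (t₅ : Tree S) : Prop :=
  t = C₁.fill (C₂.fill (C₃.fill (C₄.fill t₅))) ∧
  (C₂.comp (C₃.comp C₄)).height ≤ p ∧
  0 < C₂.height + C₄.height ∧
  ∀ i : ℕ, C₁.fill ((pump C₂ C₃ C₄ i).fill t₅) ∈ T

/-- `p` is a pumping height of `T`: all trees of `T` higher than `p` can be pumped. -/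
def IsPumpingHeight {S : Signature} (T : Set (Tree S)) (p : ℕ) : Prop :=
  ∀ t ∈ T, p < t.height →
    ∃ (C₁ C₂ C₃ C₄ : Ctx S) (t₅ : Tree S), IsPumpingDecomposition T p t C₁ C₂ C₃ C₄ t₅

/-! The HR algebra with `k` sources -/

/-- Finite directed multigraphs with edge labels in `L` and at most `k` sources: `edges` lists the
edges as (origin, label, target), and `src a` is the node with source name `a`, if any. -/
structure SGraph (k : ℕ) (L : Type) where
  V : Type
  finite_V : Finite V
  edges : Multiset (V × L × V)
  src : Fin k → Option V

/-- Isomorphism of s-graphs. -/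
def SGraph.Iso {k : ℕ} {L : Type} (g g' : SGraph k L) : Prop :=
  ∃ e : g.V ≃ g'.V, g.edges.map (fun x => (e x.1, x.2.1, e x.2.2)) = g'.edges ∧
    ∀ a, (g.src a).map e = g'.src a

/-- Two nodes of the disjoint union are to be fused when they carry the same source name. -/
def SGraph.Glue {k : ℕ} {L : Type} (g g' : SGraph k L) : g.V ⊕ g'.V → g.V ⊕ g'.V → Prop :=
  fun u v => ∃ (a : Fin k) (x : g.V) (y : g'.V),
    g.src a = some x ∧ g'.src a = some y ∧ u = Sum.inl x ∧ v = Sum.inr y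

/-- Parallel composition: disjoint union, followed by the fusion of equally named sources. -/
def SGraph.merge {k : ℕ} {L : Type} (g g' : SGraph k L) : SGraph k L where
  V := Quot (g.Glue g')
  finite_V := by
    have := g.finite_V
    have := g'.finite_V
    exact Finite.of_surjective (Quot.mk (g.Glue g')) Quot.mk_surjective
  edges :=
    g.edges.map (fun x => (Quot.mk _ (Sum.inl x.1), x.2.1, Quot.mk _ (Sum.inl x.2.2))) +
    g'.edges.map (fun x => (Quot.mk _ (Sum.inr x.1), x.2.1, Quot.mk _ (Sum.inr x.2.2)))
  src a :=
    ((g.src a).map fun x => Quot.mk _ (Sum.inl x)).or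
      ((g'.src a).map fun y => Quot.mk _ (Sum.inr y))

/-- Renaming of the source names: the `a`-source becomes the `π a`-source. -/
def SGraph.rename {k : ℕ} {L : Type} (π : Equiv.Perm (Fin k)) (g : SGraph k L) : SGraph k L :=
  { g with src := fun a => g.src (π.symm a) }

/-- The node with source name `a` ceases to be the `a`-source. -/
def SGraph.forget {k : ℕ} {L : Type} (a : Fin k) (g : SGraph k L) : SGraph k L :=
  { g with src := fun b => if b = a then none else g.src b }

/-- Terms over the HR algebra with `k` sources, with variables in `X`. -/
inductive HRTerm (k : ℕ) (L : Type) (X : Type) : Type 1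
  | var (x : X) : HRTerm k L X
  | const (g : SGraph k L) : HRTerm k L X
  | merge (s t : HRTerm k L X) : HRTerm k L X
  | rename (π : Equiv.Perm (Fin k)) (t : HRTerm k L X) : HRTerm k L X
  | forget (a : Fin k) (t : HRTerm k L X) : HRTerm k L X

/-- Substitution of terms for variables. -/
def HRTerm.subst {k : ℕ} {L X Y : Type} (σ : X → HRTerm k L Y) : HRTerm k L X → HRTerm k L Y
  | .var x => σ x
  | .const g => .const g
  | .merge s t => .merge (s.subst σ) (t.subst σ)
  | .rename π t => .rename π (t.subst σ)
  | .forget a t => .forget a (t.subst σ)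

/-- The value of a closed term in the HR algebra. -/
def HRTerm.eval {k : ℕ} {L : Type} : HRTerm k L Empty → SGraph k L
  | .var x => x.elim
  | .const g => g
  | .merge s t => s.eval.merge t.eval
  | .rename π t => t.eval.rename π
  | .forget a t => t.eval.forget a

/-- The number of edges generated by a term (variables generate none). -/
def HRTerm.edgeCount {k : ℕ} {L X : Type} : HRTerm k L X → ℕ
  | .var _ => 0
  | .const g => g.edges.card
  | .merge s t => s.edgeCount + t.edgeCount
  | .rename _ t => t.edgeCount
  | .forget _ t => t.edgeCount

/-- A tree homomorphism into the terms over the HR algebra with `k` sources: a term with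
variables `x₁, …, xₙ` for every symbol of rank `n`. -/
def HRHom (S : Signature) (k : ℕ) (L : Type) : Type 1 :=
  (f : S.Sym) → HRTerm k L (Fin (S.rank f))

/-- The image of a tree under a tree homomorphism. -/
def HRHom.tree {S : Signature} {k : ℕ} {L : Type} (h : HRHom S k L) :
    Tree S → HRTerm k L Empty
  | .node f ts => (h f).subst fun j => h.tree (ts j)

/-- The image of a context under a tree homomorphism, with one variable for the hole. -/
def HRHom.ctx {S : Signature} {k : ℕ} {L : Type} (h : HRHom S k L) :
    Ctx S → HRTerm k L Unit
  | .hole => .var ()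
  | .node f i ts C => (h f).subst fun j =>
      if hj : j = i then h.ctx C else (h.tree (ts ⟨j, hj⟩)).subst fun x => x.elim

/-- The string-graph relation described by a grammar, the projective yield and a homomorphism;
graphs are taken up to isomorphism. -/
def REL {S : Signature} {W : Type} {k : ℕ} {L : Type} (G : LMCFTG S) (lex : S.Sym → Option W)
    (h : HRHom S k L) : Set (List W × SGraph k L) :=
  {q | ∃ t ∈ G.language, q.1 = t.yield lex ∧ (h.tree t).eval.Iso q.2}

/-- The numbers of string tokens and the numbers of edges that are generated by contexts of height
at most `p`. -/
def generatedSizes {S : Signature} {W : Type} {k : ℕ} {L : Type} (lex : S.Sym → Option W)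
    (h : HRHom S k L) (p : ℕ) : Set ℕ :=
  {n | ∃ C : Ctx S, C.height ≤ p ∧ (n = (C.yield lex).length ∨ n = (h.ctx C).edgeCount)}

/-! The string language of cross-serial dependencies -/

/-- The four core letters. -/
inductive Letter
  | a | b | c | d
  deriving DecidableEq

/-- Tokens: the core letters, their barred copies, and two brackets. -/
inductive Token
  | core (x : Letter)
  | bar (x : Letter)
  | lbr
  | rbr
  deriving DecidableEq

/-- The word consisting of `x`, then `i` opening brackets, `i` barred copies of `x`, and `i`
closing brackets. -/
def block (x : Letter) (i : ℕ) : List Token :=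
  Token.core x :: (List.replicate i Token.lbr ++ List.replicate i (Token.bar x) ++
    List.replicate i Token.rbr)

/-- The strings of `AᵐBⁿCᵐDⁿ` with `m, n ≥ 1`, where `A`, `B`, `C`, `D` are the sets of blocks of the
letters `a`, `b`, `c`, `d`; the bracket depths of the blocks are independent of each other. -/
def CSDStrings : Set (List Token) :=
  {w | ∃ α β γ δ : List ℕ, α ≠ [] ∧ β ≠ [] ∧ α.length = γ.length ∧ β.length = δ.length ∧
    w = α.flatMap (block .a) ++ β.flatMap (block .b) ++ γ.flatMap (block .c) ++
      δ.flatMap (block .d)}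

/-- The pairs `x/y` of letters that depend on each other, in both orders. -/
def SepPairs : Set (Letter × Letter) :=
  {(.a, .c), (.c, .a), (.b, .d), (.d, .b)}

/-- `t` is `x,y,l`-separated: `t = Dₓ[D₀[t_y]]`, where `Dₓ` generates no `y`, the tree `t_y` generates
no `x`, and `D₀` generates at most `l` occurrences of `x`. -/
def IsSeparated {S : Signature} (lex : S.Sym → Option Token) (x y : Letter) (l : ℕ)
    (t : Tree S) : Prop :=
  ∃ (Dx D₀ : Ctx S) (ty : Tree S), t = Dx.fill (D₀.fill ty) ∧
    (Dx.yield lex).count (.core y) = 0 ∧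
    (D₀.yield lex).count (.core x) ≤ l ∧
    (ty.yield lex).count (.core x) = 0

end CrossSerial

open CrossSerial

/-! Pumping height: along a derivation, the forms from which pieces of it are derived come from a
finite set. If a form recurs below itself with a smaller result, the part between the two
occurrences can be pumped; a derivation without such a recurrence is of bounded size.

Separation: if `t` is neither `a,c`- nor `d,b`-separated, then its letters spread at some node:
below it there are all letters `b` and `c` and more than `l₀` letters `a` and `d`, but no child of
it has both an `a` and a `c`, both a `b` and a `d`, or both an `a` and a `d`. Replacing
`C₂[C₃[C₄]]` by `C₃` preserves this: the string stays in the language, so as many letters `a` as `c`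
and as many `b` as `d` are erased, hence none at all below a single child of the node or beside the
node. Pumping down thus ends at a tree of height at most `p` whose letters spread; but then a
context of height at most `p` generates more than `l₀` letters `a`. -/

namespace CrossSerial

variable {S : Signature}

/-! ### Trees and contexts -/

theorem Ctx.fill_comp (C D : Ctx S) (t : Tree S) : (C.comp D).fill t = C.fill (D.fill t) := by
  induction C with
  | hole => rfl
  | node f i ts C ih => simp only [Ctx.comp, Ctx.fill, ih]

theorem Ctx.comp_hole (C : Ctx S) : C.comp .hole = C := by
  induction C with
  | hole => rfl
  | node f i ts C ih => simp only [Ctx.comp, ih]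

theorem Ctx.comp_assoc (C D E : Ctx S) : (C.comp D).comp E = C.comp (D.comp E) := by
  induction C with
  | hole => rfl
  | node f i ts C ih => simp only [Ctx.comp, ih]

/-- The one-level context around the `i`-th child of `node f ts`; the tree `ts i` itself is
ignored. -/
def Ctx.around (f : S.Sym) (ts : Fin (S.rank f) → Tree S) (i : Fin (S.rank f)) : Ctx S :=
  .node f i (fun j => ts j.1) .hole

theorem Ctx.around_fill (f : S.Sym) (ts : Fin (S.rank f) → Tree S) (i : Fin (S.rank f))
    (t : Tree S) : (Ctx.around f ts i).fill t = .node f (Function.update ts i t) := by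
  simp only [Ctx.around, Ctx.fill, Tree.node.injEq, heq_eq_eq, true_and]
  funext j
  rw [Function.update_apply]
  split_ifs <;> rfl

theorem Ctx.around_fill_self (f : S.Sym) (ts : Fin (S.rank f) → Tree S) (i : Fin (S.rank f)) :
    (Ctx.around f ts i).fill (ts i) = .node f ts := by
  rw [Ctx.around_fill, Function.update_eq_self]

theorem Ctx.around_comp_fill (f : S.Sym) (ts : Fin (S.rank f) → Tree S) (i : Fin (S.rank f))
    (C : Ctx S) (t : Tree S) :
    ((Ctx.around f ts i).comp C).fill t = .node f (Function.update ts i (C.fill t)) := by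
  rw [Ctx.fill_comp, Ctx.around_fill]

theorem Ctx.node_eq_around_comp {f : S.Sym} {i : Fin (S.rank f)}
    {us : {j : Fin (S.rank f) // j ≠ i} → Tree S} {C : Ctx S} {t : Tree S}
    {ts : Fin (S.rank f) → Tree S} (h : (Ctx.node f i us C).fill t = .node f ts) :
    Ctx.node f i us C = (Ctx.around f ts i).comp C ∧ ts i = C.fill t := by
  obtain rfl := eq_of_heq (Tree.node.inj h).2
  refine ⟨?_, dif_pos rfl⟩
  simp only [Ctx.around, Ctx.comp, Ctx.node.injEq, heq_eq_eq, true_and, and_true]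
  funext j
  rw [dif_neg j.2]

theorem Ctx.eq_around_comp_of_fill_eq_node {C : Ctx S} {t : Tree S} {f : S.Sym}
    {ts : Fin (S.rank f) → Tree S} (h : C.fill t = .node f ts) :
    C = .hole ∨ ∃ i D, C = (Ctx.around f ts i).comp D ∧ ts i = D.fill t := by
  cases C with
  | hole => exact .inl rfl
  | node g i us D =>
    obtain rfl := (Tree.node.inj h).1
    exact .inr ⟨i, D, Ctx.node_eq_around_comp h⟩

theorem Ctx.nested_or_diverging_of_fill_eq {C D : Ctx S} {s u : Tree S} (h : C.fill s = D.fill u) :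
    (∃ E, D = C.comp E ∧ s = E.fill u) ∨ (∃ E, C = D.comp E ∧ u = E.fill s) ∨
      ∃ (K : Ctx S) (f : S.Sym) (ts : Fin (S.rank f) → Tree S) (i j : Fin (S.rank f))
        (C' D' : Ctx S), i ≠ j ∧ C = K.comp ((around f ts i).comp C') ∧
          D = K.comp ((around f ts j).comp D') ∧ ts i = C'.fill s ∧ ts j = D'.fill u := by
  induction C generalizing D with
  | hole => exact .inl ⟨D, rfl, h⟩
  | node f i us C ih =>
    set ts : Fin (S.rank f) → Tree S := fun j => if hj : j = i then C.fill s else us ⟨j, hj⟩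
    obtain ⟨hC, hi⟩ := Ctx.node_eq_around_comp (ts := ts) (t := s) rfl
    rw [hC]
    obtain rfl | ⟨j, D, rfl, hj⟩ := Ctx.eq_around_comp_of_fill_eq_node (f := f) (ts := ts) h.symm
    · exact .inr (.inl ⟨_, rfl, h.symm.trans (congrArg (Ctx.fill · s) hC)⟩)
    obtain rfl | hij := eq_or_ne i j
    · obtain ⟨E, rfl, hE⟩ | ⟨E, rfl, hE⟩ | ⟨K, g, vs, k, l, C', D', hkl, rfl, rfl, hk, hl⟩ :=
        ih (hi.symm.trans hj)
      · exact .inl ⟨E, (Ctx.comp_assoc _ _ _).symm, hE⟩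
      · exact .inr (.inl ⟨E, (Ctx.comp_assoc _ _ _).symm, hE⟩)
      · exact .inr (.inr ⟨(around f ts i).comp K, g, vs, k, l, C', D', hkl,
          (Ctx.comp_assoc _ _ _).symm, (Ctx.comp_assoc _ _ _).symm, hk, hl⟩)
    · exact .inr (.inr ⟨.hole, f, ts, i, j, C, D, hij, rfl, rfl, hi, hj⟩)

section Height

variable {f : S.Sym} {ts : Fin (S.rank f) → Tree S} {i : Fin (S.rank f)}
  {us : {j : Fin (S.rank f) // j ≠ i} → Tree S} {C : Ctx S} {b : ℕ}

theorem Tree.height_node_le_succ_iff :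
    (Tree.node f ts).height ≤ b + 1 ↔ ∀ j, (ts j).height ≤ b := by
  simp [Tree.height, add_comm 1]

theorem Ctx.height_node_le_succ_iff :
    (Ctx.node f i us C).height ≤ b + 1 ↔ (∀ j, (us j).height ≤ b) ∧ C.height ≤ b := by
  simp [Ctx.height, add_comm 1]

theorem Tree.height_pos (t : Tree S) : 0 < t.height := by
  cases t
  simp [Tree.height]

theorem Tree.height_child_lt (ts : Fin (S.rank f) → Tree S) (j : Fin (S.rank f)) :
    (ts j).height < (Tree.node f ts).height := by
  obtain ⟨b, hb⟩ := Nat.exists_eq_add_one.2 (Tree.node f ts).height_pos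
  rw [hb, Nat.lt_succ_iff]
  exact Tree.height_node_le_succ_iff.1 hb.le j

theorem Ctx.height_pos (hC : C ≠ .hole) : 0 < C.height := by
  cases C with
  | hole => exact absurd rfl hC
  | node f i us C => simp [Ctx.height]

theorem Ctx.height_side_lt (us : {j : Fin (S.rank f) // j ≠ i} → Tree S) (C : Ctx S)
    (j : {j : Fin (S.rank f) // j ≠ i}) : (us j).height < (Ctx.node f i us C).height := by
  obtain ⟨b, hb⟩ := Nat.exists_eq_add_one.2 (Ctx.height_pos (C := .node f i us C) nofun)
  rw [hb, Nat.lt_succ_iff]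
  exact (Ctx.height_node_le_succ_iff.1 hb.le).1 j

theorem Ctx.height_spine_lt (us : {j : Fin (S.rank f) // j ≠ i} → Tree S) (C : Ctx S) :
    C.height < (Ctx.node f i us C).height := by
  simp only [Ctx.height]
  omega

end Height

theorem Ctx.height_fill_le (C : Ctx S) (t : Tree S) : (C.fill t).height ≤ C.height + t.height := by
  induction C with
  | hole => simp [Ctx.height, Ctx.fill]
  | node f i us C ih =>
    suffices ((Ctx.node f i us C).fill t).height
        ≤ (Ctx.node f i us C).height - 1 + t.height + 1 by
      have := Ctx.height_spine_lt us C
      omega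
    refine Tree.height_node_le_succ_iff.2 fun j => ?_
    split_ifs with hj
    · have := Ctx.height_spine_lt us C
      omega
    · have := Ctx.height_side_lt us C ⟨j, hj⟩
      omega

theorem Ctx.height_comp_le (C D : Ctx S) : (C.comp D).height ≤ C.height + D.height := by
  induction C with
  | hole => simp [Ctx.height, Ctx.comp]
  | node f i us C ih =>
    suffices ((Ctx.node f i us C).comp D).height
        ≤ (Ctx.node f i us C).height - 1 + D.height + 1 by
      have := Ctx.height_spine_lt us C
      omega
    refine Ctx.height_node_le_succ_iff.2 ⟨fun j => ?_, ?_⟩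
    · have := Ctx.height_side_lt us C j
      omega
    · have := Ctx.height_spine_lt us C
      omega

theorem Ctx.height_le_height_fill (C : Ctx S) (t : Tree S) : C.height ≤ (C.fill t).height := by
  induction C with
  | hole => exact Nat.zero_le _
  | node f i us C ih =>
    obtain ⟨b, hb⟩ := Nat.exists_eq_add_one.2 ((Ctx.node f i us C).fill t).height_pos
    have hle : ∀ j, _ ≤ b := Tree.height_node_le_succ_iff.1 hb.le
    rw [hb]
    refine Ctx.height_node_le_succ_iff.2 ⟨fun j => ?_, ih.trans ?_⟩
    · simpa only [dif_neg j.2] using hle j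
    · simpa only [dif_pos] using hle i

theorem Tree.height_le_height_fill (C : Ctx S) (t : Tree S) : t.height ≤ (C.fill t).height := by
  induction C with
  | hole => exact le_rfl
  | node f i us C ih =>
    refine ih.trans (le_of_eq_of_le ?_ (Tree.height_child_lt _ i).le)
    rw [dif_pos rfl]

theorem Ctx.height_outer_le_height_comp (C D : Ctx S) : C.height ≤ (C.comp D).height := by
  induction C with
  | hole => exact Nat.zero_le _
  | node f i us C ih =>
    simp only [Ctx.comp, Ctx.height]
    omega

theorem Ctx.height_inner_le_height_comp (C D : Ctx S) : D.height ≤ (C.comp D).height := by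
  induction C with
  | hole => exact le_rfl
  | node f i us C ih => exact ih.trans (Ctx.height_spine_lt us _).le

/-- The number of symbols of a tree. -/
def Tree.size : Tree S → ℕ
  | .node _ ts => 1 + ∑ j, (ts j).size

/-- The number of symbols of a context, the hole not counted. -/
def Ctx.size : Ctx S → ℕ
  | .hole => 0
  | .node _ _ us C => 1 + ∑ j, (us j).size + C.size

theorem Ctx.size_fill (C : Ctx S) (t : Tree S) : (C.fill t).size = C.size + t.size := by
  induction C with
  | hole => simp [Ctx.size, Ctx.fill]
  | node f i us C ih =>
    have hside : ∀ j : {j // j ≠ i},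
        (if hj : j.1 = i then C.fill t else us ⟨j.1, hj⟩).size = (us j).size :=
      fun j => by rw [dif_neg j.2]
    simp only [Ctx.fill, Tree.size, Ctx.size, Fintype.sum_eq_add_sum_subtype_ne _ i, hside,
      dif_pos, ih]
    ring

theorem Ctx.size_pos {C : Ctx S} (hC : 0 < C.height) : 0 < C.size := by
  cases C with
  | hole => simp [Ctx.height] at hC
  | node f i us C => simp only [Ctx.size]; omega

theorem finite_trees_height_le [Finite S.Sym] (p : ℕ) : {t : Tree S | t.height ≤ p}.Finite := by
  induction p with
  | zero =>
    refine Set.finite_empty.subset fun t ht => ?_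
    exact absurd ht t.height_pos.not_ge
  | succ p ih =>
    have : Finite {t : Tree S | t.height ≤ p} := ih
    refine (Set.finite_range fun x : Σ f : S.Sym, Fin (S.rank f) → {t : Tree S | t.height ≤ p} =>
      Tree.node x.1 fun j => x.2 j).subset ?_
    rintro ⟨f, ts⟩ ht
    exact ⟨⟨f, fun j => ⟨ts j, Tree.height_node_le_succ_iff.1 ht j⟩⟩, rfl⟩

theorem finite_contexts_height_le [Finite S.Sym] (p : ℕ) : {C : Ctx S | C.height ≤ p}.Finite := by
  induction p with
  | zero =>
    refine (Set.finite_singleton Ctx.hole).subset fun C hC => ?_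
    by_contra hne
    exact (Ctx.height_pos hne).not_ge hC
  | succ p ih =>
    have : Finite {C : Ctx S | C.height ≤ p} := ih
    have : Finite {t : Tree S | t.height ≤ p} := finite_trees_height_le p
    refine ((Set.finite_singleton Ctx.hole).union (Set.finite_range
      fun x : Σ f : S.Sym, Σ i : Fin (S.rank f),
          ({j // j ≠ i} → {t : Tree S | t.height ≤ p}) × {C : Ctx S | C.height ≤ p} =>
        Ctx.node x.1 x.2.1 (fun j => x.2.2.1 j) x.2.2.2)).subset ?_
    rintro (_ | ⟨f, i, us, C⟩) hC
    · exact .inl rfl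
    · obtain ⟨hus, hC⟩ := Ctx.height_node_le_succ_iff.1 hC
      exact .inr ⟨⟨f, i, fun j => ⟨us j, hus j⟩, ⟨C, hC⟩⟩, rfl⟩

theorem exists_isGreatest_generatedSizes [Finite S.Sym] {W L : Type} {k : ℕ}
    (lex : S.Sym → Option W) (h : HRHom S k L) (p : ℕ) :
    ∃ l, IsGreatest (generatedSizes lex h p) l := by
  have hfin : (generatedSizes lex h p).Finite := by
    refine (((finite_contexts_height_le p).image fun C => (C.yield lex).length).union
      ((finite_contexts_height_le p).image fun C => (h.ctx C).edgeCount)).subset ?_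
    rintro n ⟨C, hC, rfl | rfl⟩
    · exact .inl ⟨C, hC, rfl⟩
    · exact .inr ⟨C, hC, rfl⟩
  have hne : (generatedSizes lex h p).Nonempty := ⟨_, .hole, Nat.zero_le p, .inl rfl⟩
  exact ⟨_, Nat.sSup_mem hne hfin.bddAbove, fun n hn => le_csSup hfin.bddAbove hn⟩

section Yield

variable {W : Type} (lex : S.Sym → Option W)

theorem flatMap_finRange_split {α : Type*} {n : ℕ} (g : Fin n → List α) (i : Fin n) :
    (List.finRange n).flatMap g =
      ((List.finRange n).flatMap fun j => if j < i then g j else []) ++ g i ++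
        ((List.finRange n).flatMap fun j => if i < j then g j else []) := by
  induction n with
  | zero => exact i.elim0
  | succ n ih =>
    simp only [List.finRange_succ, List.flatMap_cons, List.flatMap_map]
    refine Fin.cases ?_ (fun i => ?_) i
    · simp
    · rw [ih (fun j => g j.succ) i]
      simp

theorem Ctx.yield_fill (C : Ctx S) (t : Tree S) :
    (C.fill t).yield lex = C.left lex ++ t.yield lex ++ C.right lex := by
  induction C with
  | hole => simp [Ctx.fill, Ctx.left, Ctx.right]
  | node f i us C ih =>
    have hl : ∀ j, (if j < i then (if hj : j = i then C.fill t else us ⟨j, hj⟩).yield lex else []) =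
        if hj : j < i then (us ⟨j, ne_of_lt hj⟩).yield lex else [] := fun j => by
      split_ifs with hj hji
      exacts [absurd hji hj.ne, rfl, rfl]
    have hr : ∀ j, (if i < j then (if hj : j = i then C.fill t else us ⟨j, hj⟩).yield lex else []) =
        if hj : i < j then (us ⟨j, ne_of_gt hj⟩).yield lex else [] := fun j => by
      split_ifs with hj hji
      exacts [absurd hji hj.ne', rfl, rfl]
    simp only [Ctx.fill, Tree.yield, if_neg i.pos.ne', Ctx.left, Ctx.right]
    rw [flatMap_finRange_split _ i]
    simp only [hl, hr, dif_pos, ih, List.append_assoc]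

theorem Ctx.left_comp (C D : Ctx S) : (C.comp D).left lex = C.left lex ++ D.left lex := by
  induction C with
  | hole => simp [Ctx.comp, Ctx.left]
  | node f i us C ih => simp [Ctx.comp, Ctx.left, ih]

theorem Ctx.right_comp (C D : Ctx S) : (C.comp D).right lex = D.right lex ++ C.right lex := by
  induction C with
  | hole => simp [Ctx.comp, Ctx.right]
  | node f i us C ih => simp [Ctx.comp, Ctx.right, ih]

variable [DecidableEq W] (x : W)

theorem Ctx.count_yield_fill (C : Ctx S) (t : Tree S) :
    ((C.fill t).yield lex).count x = (C.yield lex).count x + (t.yield lex).count x := by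
  simp only [Ctx.yield_fill, Ctx.yield, List.count_append]
  omega

theorem Ctx.count_yield_comp (C D : Ctx S) :
    ((C.comp D).yield lex).count x = (C.yield lex).count x + (D.yield lex).count x := by
  simp only [Ctx.left_comp, Ctx.right_comp, Ctx.yield, List.count_append]
  omega

theorem Tree.count_yield_node {f : S.Sym} (hf : S.rank f ≠ 0) (ts : Fin (S.rank f) → Tree S) :
    ((Tree.node f ts).yield lex).count x = ∑ j, ((ts j).yield lex).count x := by
  simp only [Tree.yield, if_neg hf, List.count_flatMap, Fin.sum_univ_def, Function.comp_def]

theorem Ctx.count_yield_around_add (f : S.Sym) (ts : Fin (S.rank f) → Tree S)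
    (i : Fin (S.rank f)) :
    ((Ctx.around f ts i).yield lex).count x + ((ts i).yield lex).count x =
      ((Tree.node f ts).yield lex).count x := by
  rw [← Ctx.count_yield_fill, Ctx.around_fill_self]

theorem Ctx.count_yield_le_around (f : S.Sym) (ts : Fin (S.rank f) → Tree S)
    {i j : Fin (S.rank f)} (hij : i ≠ j) :
    ((ts j).yield lex).count x ≤ ((Ctx.around f ts i).yield lex).count x := by
  have hadd := Ctx.count_yield_around_add lex x f ts i
  have hle := Finset.add_le_sum (f := fun j => ((ts j).yield lex).count x)
    (fun _ _ => Nat.zero_le _) (Finset.mem_univ i) (Finset.mem_univ j) hij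
  rw [Tree.count_yield_node lex x i.pos.ne'] at hadd
  omega

theorem exists_leaf_of_count_pos {x y : W} (hxy : x ≠ y) (s : Tree S)
    (hy : 0 < (s.yield lex).count y) :
    ∃ (D : Ctx S) (u : Tree S), s = D.fill u ∧ (u.yield lex).count x = 0 := by
  induction s with
  | node f ts ih =>
    by_cases hf : S.rank f = 0
    · refine ⟨.hole, _, rfl, ?_⟩
      simp only [Tree.yield, if_pos hf, List.count_pos_iff, Option.mem_toList] at hy
      simp [Tree.yield, hf, hy, hxy.symm]
    · rw [Tree.count_yield_node lex y hf, Finset.sum_pos_iff] at hy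
      obtain ⟨j, -, hj⟩ := hy
      obtain ⟨D, u, hD, hu⟩ := ih j hj
      exact ⟨(Ctx.around f ts j).comp D, u, by rw [Ctx.fill_comp, ← hD, Ctx.around_fill_self], hu⟩

end Yield

section CoreLetters

/-- The core letter that a token is, if any. -/
def Token.letter? : Token → Option Letter
  | .core x => some x
  | _ => none

/-- The core letters of a string, in order: what remains of a string of `CSDStrings` when bars and
brackets are dropped. -/
def coreLetters (w : List Token) : List Letter :=
  w.filterMap Token.letter?

/-- The position of a core letter in the alphabet. -/
def Letter.index : Letter → ℕ
  | .a => 0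
  | .b => 1
  | .c => 2
  | .d => 3

variable {w : List Token}

theorem count_coreLetters (x : Letter) : (coreLetters w).count x = w.count (.core x) := by
  rw [coreLetters, List.count_filterMap, List.count]
  congr 1
  funext u
  cases u <;> simp [Token.letter?]

theorem coreLetters_append (v w : List Token) :
    coreLetters (v ++ w) = coreLetters v ++ coreLetters w :=
  List.filterMap_append

theorem coreLetters_blocks (x : Letter) (α : List ℕ) :
    coreLetters (α.flatMap (block x)) = List.replicate α.length x := by
  induction α with
  | nil => rfl
  | cons i α ih =>
    rw [List.flatMap_cons, coreLetters_append, ih]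
    simp [coreLetters, block, Token.letter?, List.replicate_succ, List.filterMap_replicate]

theorem exists_coreLetters_eq (hw : w ∈ CSDStrings) :
    ∃ m n, 0 < m ∧ 0 < n ∧ coreLetters w = List.replicate m .a ++ List.replicate n .b ++
      List.replicate m .c ++ List.replicate n .d := by
  obtain ⟨α, β, γ, δ, hα, hβ, hαγ, hβδ, rfl⟩ := hw
  refine ⟨α.length, β.length, List.length_pos_of_ne_nil hα, List.length_pos_of_ne_nil hβ, ?_⟩
  simp only [coreLetters_append, coreLetters_blocks, hαγ, hβδ]

theorem count_a_eq_count_c (hw : w ∈ CSDStrings) :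
    w.count (.core .a) = w.count (.core .c) := by
  obtain ⟨m, n, -, -, h⟩ := exists_coreLetters_eq hw
  simp [← count_coreLetters, h, List.count_replicate]

theorem count_b_eq_count_d (hw : w ∈ CSDStrings) :
    w.count (.core .b) = w.count (.core .d) := by
  obtain ⟨m, n, -, -, h⟩ := exists_coreLetters_eq hw
  simp [← count_coreLetters, h, List.count_replicate]

theorem count_core_pos (hw : w ∈ CSDStrings) (x : Letter) : 0 < w.count (.core x) := by
  obtain ⟨m, n, hm, hn, h⟩ := exists_coreLetters_eq hw
  cases x <;> simpa [← count_coreLetters, h, List.count_replicate]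

theorem pairwise_index_coreLetters (hw : w ∈ CSDStrings) :
    (coreLetters w).Pairwise fun x y => x.index ≤ y.index := by
  obtain ⟨m, n, -, -, h⟩ := exists_coreLetters_eq hw
  simp [h, List.pairwise_append, List.pairwise_replicate, Letter.index, or_imp, forall_and]

theorem count_ctx_eq_zero_of_index_lt {lex : S.Sym → Option Token} {D : Ctx S} {s : Tree S}
    (hw : (D.fill s).yield lex ∈ CSDStrings) {x y z : Letter} (hxy : x.index < y.index)
    (hyz : y.index < z.index) (hx : 0 < (s.yield lex).count (.core x))
    (hz : 0 < (s.yield lex).count (.core z)) : (D.yield lex).count (.core y) = 0 := by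
  have hsorted := pairwise_index_coreLetters hw
  rw [Ctx.yield_fill, coreLetters_append, coreLetters_append, List.append_assoc,
    List.pairwise_append, List.pairwise_append] at hsorted
  obtain ⟨-, ⟨-, -, hright⟩, hleft⟩ := hsorted
  rw [← count_coreLetters, List.count_pos_iff] at hx hz
  rw [← count_coreLetters, List.count_eq_zero, Ctx.yield, coreLetters_append, List.mem_append]
  rintro (hy | hy)
  · exact hxy.not_ge (hleft y hy x (List.mem_append_left _ hx))
  · exact hyz.not_ge (hright z hz y hy)

end CoreLetters

/-! ### Separation -/

section Separation

variable {lex : S.Sym → Option Token} {l : ℕ}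

theorem lt_count_of_not_isSeparated {x y : Letter} (hxy : x ≠ y) {D : Ctx S} {s : Tree S}
    (hsep : ¬ IsSeparated lex x y l (D.fill s)) (hD : (D.yield lex).count (.core y) = 0)
    (hy : 0 < ((D.fill s).yield lex).count (.core y)) :
    l < (s.yield lex).count (.core x) := by
  by_contra! hle
  rw [Ctx.count_yield_fill, hD, zero_add] at hy
  obtain ⟨D₀, u, rfl, hu⟩ := exists_leaf_of_count_pos lex (mt Token.core.inj hxy) s hy
  rw [Ctx.count_yield_fill] at hle
  exact hsep ⟨D, D₀, u, rfl, hD, (Nat.le_add_right _ _).trans hle, hu⟩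

/-- The letters spread at the root of `node f ts`: there are more than `l` letters `a` and more
than `l` letters `d` below it, but none of its children has both an `a` and a `c`, or both a `b`
and a `d`, or both an `a` and a `d`. -/
structure IsSpread (lex : S.Sym → Option Token) (l : ℕ) (f : S.Sym)
    (ts : Fin (S.rank f) → Tree S) : Prop where
  lt_a : l < ((Tree.node f ts).yield lex).count (.core .a)
  lt_d : l < ((Tree.node f ts).yield lex).count (.core .d)
  ac : ∀ j, ((ts j).yield lex).count (.core .a) = 0 ∨ ((ts j).yield lex).count (.core .c) = 0
  bd : ∀ j, ((ts j).yield lex).count (.core .b) = 0 ∨ ((ts j).yield lex).count (.core .d) = 0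
  ad : ∀ j, ((ts j).yield lex).count (.core .a) = 0 ∨ ((ts j).yield lex).count (.core .d) = 0

/-- The letters spread at some node of `t` that has all letters `b` and `c` of `t` below it. This
is the invariant which pumping down preserves. -/
def HasSpread (lex : S.Sym → Option Token) (l : ℕ) (t : Tree S) : Prop :=
  ∃ (D : Ctx S) (f : S.Sym) (ts : Fin (S.rank f) → Tree S), t = D.fill (.node f ts) ∧
    (D.yield lex).count (.core .b) = 0 ∧ (D.yield lex).count (.core .c) = 0 ∧ IsSpread lex l f ts

theorem exists_minimal_subtree {W : Type} [DecidableEq W] (lex : S.Sym → Option W) (x : W)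
    (s : Tree S) {D : Ctx S} (hD : (D.yield lex).count x = 0) :
    ∃ (D' : Ctx S) (f : S.Sym) (ts : Fin (S.rank f) → Tree S), D.fill s = D'.fill (.node f ts) ∧
      (D'.yield lex).count x = 0 ∧
      ∀ j, ((D'.comp (Ctx.around f ts j)).yield lex).count x ≠ 0 := by
  induction s generalizing D with
  | node f ts ih =>
    by_cases h : ∃ j, ((D.comp (Ctx.around f ts j)).yield lex).count x = 0
    · obtain ⟨j, hj⟩ := h
      obtain ⟨D', g, us, heq, h'⟩ := ih j hj
      exact ⟨D', g, us, by rw [← heq, Ctx.fill_comp, Ctx.around_fill_self], h'⟩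
    · exact ⟨D, f, ts, rfl, hD, not_exists.1 h⟩

theorem count_ctx_b_eq_zero_iff {D : Ctx S} {s : Tree S} (hw : (D.fill s).yield lex ∈ CSDStrings)
    (hac : ¬ IsSeparated lex .a .c l (D.fill s)) (hdb : ¬ IsSeparated lex .d .b l (D.fill s)) :
    (D.yield lex).count (.core .b) = 0 ↔ (D.yield lex).count (.core .c) = 0 := by
  have hsum := fun x => Ctx.count_yield_fill lex (.core x) D s
  constructor <;> intro hD
  · have hb := count_core_pos hw .b
    have hd := lt_count_of_not_isSeparated (by decide) hdb hD hb
    rw [hsum, hD, zero_add] at hb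
    exact count_ctx_eq_zero_of_index_lt hw (by decide) (by decide) hb (Nat.zero_lt_of_lt hd)
  · have hc := count_core_pos hw .c
    have ha := lt_count_of_not_isSeparated (by decide) hac hD hc
    rw [hsum, hD, zero_add] at hc
    exact count_ctx_eq_zero_of_index_lt hw (by decide) (by decide) (Nat.zero_lt_of_lt ha) hc

theorem hasSpread_of_not_isSeparated {t : Tree S} (hw : t.yield lex ∈ CSDStrings)
    (hac : ¬ IsSeparated lex .a .c l t) (hdb : ¬ IsSeparated lex .d .b l t) :
    HasSpread lex l t := by
  obtain ⟨D, f, ts, hD, hb, hmin⟩ := exists_minimal_subtree lex (.core .b) t (D := .hole) rfl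
  obtain rfl : t = D.fill (.node f ts) := hD
  have hc := (count_ctx_b_eq_zero_iff hw hac hdb).1 hb
  have hchild : ∀ j, D.fill (.node f ts) = (D.comp (Ctx.around f ts j)).fill (ts j) := fun j => by
    rw [Ctx.fill_comp, Ctx.around_fill_self]
  refine ⟨D, f, ts, rfl, hb, hc,
    lt_count_of_not_isSeparated (by decide) hac hc (count_core_pos hw _),
    lt_count_of_not_isSeparated (by decide) hdb hb (count_core_pos hw _), ?_, ?_, ?_⟩ <;>
    intro j <;> by_contra! h <;>
    obtain ⟨hx, hz⟩ := And.imp Nat.pos_of_ne_zero Nat.pos_of_ne_zero h <;>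
    rw [hchild j] at hw hac hdb
  · exact hmin j (count_ctx_eq_zero_of_index_lt hw (by decide) (by decide) hx hz)
  · exact hmin j ((count_ctx_b_eq_zero_iff hw hac hdb).2
      (count_ctx_eq_zero_of_index_lt hw (by decide) (by decide) hx hz))
  · exact hmin j (count_ctx_eq_zero_of_index_lt hw (by decide) (by decide) hx hz)

/-- What is known of the numbers of core letters when `W` is replaced by `V`: there are at most `l`
of each kind in `W`, and the letters `a`, `c` and `b`, `d` are erased in pairs. -/
structure Shrinks (lex : S.Sym → Option Token) (l : ℕ) (W V : Ctx S) : Prop where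
  le_l : ∀ x, (W.yield lex).count (.core x) ≤ l
  le : ∀ x, (V.yield lex).count (.core x) ≤ (W.yield lex).count (.core x)
  ac : (W.yield lex).count (.core .a) + (V.yield lex).count (.core .c) =
    (W.yield lex).count (.core .c) + (V.yield lex).count (.core .a)
  bd : (W.yield lex).count (.core .b) + (V.yield lex).count (.core .d) =
    (W.yield lex).count (.core .d) + (V.yield lex).count (.core .b)

variable {W V : Ctx S}

theorem Shrinks.count_fill_eq (h : Shrinks lex l W V) {E : Ctx S} {t : Tree S}
    (hac : ((E.fill (W.fill t)).yield lex).count (.core .a) = 0 ∨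
      ((E.fill (W.fill t)).yield lex).count (.core .c) = 0)
    (hbd : ((E.fill (W.fill t)).yield lex).count (.core .b) = 0 ∨
      ((E.fill (W.fill t)).yield lex).count (.core .d) = 0) (x : Letter) :
    ((E.fill (V.fill t)).yield lex).count (.core x) =
      ((E.fill (W.fill t)).yield lex).count (.core x) := by
  simp only [Ctx.count_yield_fill] at hac hbd ⊢
  have := h.ac
  have := h.bd
  have := h.le .a
  have := h.le .b
  have := h.le .c
  have := h.le .d
  cases x <;> omega

section Update

variable {f : S.Sym} {ts : Fin (S.rank f) → Tree S} {i : Fin (S.rank f)} {t : Tree S}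

theorem Tree.count_yield_node_update {x : Letter}
    (h : (t.yield lex).count (.core x) = ((ts i).yield lex).count (.core x)) :
    ((Tree.node f (Function.update ts i t)).yield lex).count (.core x) =
      ((Tree.node f ts).yield lex).count (.core x) := by
  rw [← Ctx.around_fill, Ctx.count_yield_fill, h, Ctx.count_yield_around_add]

theorem Ctx.count_yield_around_update {x : Letter}
    (h : (t.yield lex).count (.core x) = ((ts i).yield lex).count (.core x))
    {j : Fin (S.rank f)} (hij : i ≠ j) :
    ((Ctx.around f (Function.update ts i t) j).yield lex).count (.core x) =
      ((Ctx.around f ts j).yield lex).count (.core x) := by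
  have hts := Ctx.count_yield_around_add lex (.core x) f ts j
  have hupd := Ctx.count_yield_around_add lex (.core x) f (Function.update ts i t) j
  rw [Function.update_of_ne hij.symm, Tree.count_yield_node_update h] at hupd
  omega

theorem IsSpread.update (hs : IsSpread lex l f ts)
    (h : ∀ x, (t.yield lex).count (.core x) = ((ts i).yield lex).count (.core x)) :
    IsSpread lex l f (Function.update ts i t) := by
  have hchild : ∀ x j, ((Function.update ts i t j).yield lex).count (.core x) =
      ((ts j).yield lex).count (.core x) := fun x j => by
    obtain rfl | hj := eq_or_ne j i
    · rw [Function.update_self, h]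
    · rw [Function.update_of_ne hj]
  obtain ⟨ha, hd, hac, hbd, had⟩ := hs
  constructor <;> simpa only [hchild, Tree.count_yield_node_update (h _)]

end Update

variable {f : S.Sym} {ts : Fin (S.rank f) → Tree S} {C₁ D : Ctx S} {t₅ : Tree S}

/- If the hole of `W` were below the node at which the letters spread, then the child on the way to
it would have both an `a` and a `d`. -/
theorem IsSpread.exists_eq_comp (hs : IsSpread lex l f ts)
    (hW : ∀ x, (W.yield lex).count (.core x) ≤ l) (h : W.fill t₅ = D.fill (.node f ts)) :
    ∃ F : Ctx S, D = W.comp F ∧ t₅ = F.fill (.node f ts) := by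
  obtain hF | ⟨F, rfl, hF⟩ | ⟨K, g, us, i, j, W', D', hij, rfl, rfl, -, hj⟩ :=
    Ctx.nested_or_diverging_of_fill_eq h
  · exact hF
  · obtain rfl | ⟨i, F, rfl, _⟩ := Ctx.eq_around_comp_of_fill_eq_node hF.symm
    · exact ⟨.hole, by simp only [Ctx.comp_hole], hF.symm⟩
    have hpos : ∀ x, l < ((Tree.node f ts).yield lex).count (.core x) →
        ((ts i).yield lex).count (.core x) ≠ 0 := fun x hx => by
      have hle := hW x
      rw [← Ctx.count_yield_around_add lex (.core x) f ts i] at hx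
      simp only [Ctx.count_yield_comp] at hle
      omega
    exact absurd (hs.ad i) (not_or.2 ⟨hpos .a hs.lt_a, hpos .d hs.lt_d⟩)
  · have hle := Ctx.count_yield_le_around lex (.core .a) g us hij
    have := hs.lt_a
    have := hW .a
    rw [hj, Ctx.count_yield_fill] at hle
    simp only [Ctx.count_yield_comp] at this
    omega

theorem IsSpread.hasSpread_of_above (hs : IsSpread lex l f ts) (hVW : Shrinks lex l W V)
    (h : W.fill t₅ = D.fill (.node f ts))
    (hb : ((C₁.comp D).yield lex).count (.core .b) = 0)
    (hc : ((C₁.comp D).yield lex).count (.core .c) = 0) :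
    HasSpread lex l (C₁.fill (V.fill t₅)) := by
  obtain ⟨F, rfl, rfl⟩ := hs.exists_eq_comp hVW.le_l h
  refine ⟨C₁.comp (V.comp F), f, ts, by simp only [Ctx.fill_comp], ?_, ?_, hs⟩
  · have := hVW.le .b
    simp only [Ctx.count_yield_comp] at hb ⊢
    omega
  · have := hVW.le .c
    simp only [Ctx.count_yield_comp] at hc ⊢
    omega

theorem IsSpread.hasSpread_of_below (hs : IsSpread lex l f ts) (hVW : Shrinks lex l W V)
    {i : Fin (S.rank f)} {E : Ctx S} (hi : ts i = E.fill (W.fill t₅))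
    (hb : (D.yield lex).count (.core .b) = 0) (hc : (D.yield lex).count (.core .c) = 0) :
    HasSpread lex l ((D.comp ((Ctx.around f ts i).comp E)).fill (V.fill t₅)) := by
  refine ⟨D, f, Function.update ts i (E.fill (V.fill t₅)), ?_, hb, hc, hs.update fun x => ?_⟩
  · rw [Ctx.fill_comp, Ctx.around_comp_fill]
  · rw [hi]
    exact hVW.count_fill_eq (hi ▸ hs.ac i) (hi ▸ hs.bd i) x

theorem IsSpread.hasSpread_of_beside (hs : IsSpread lex l f ts) (hVW : Shrinks lex l W V)
    {K C D : Ctx S} {g : S.Sym} {us : Fin (S.rank g) → Tree S} {i j : Fin (S.rank g)} (hij : i ≠ j)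
    (hi : us i = C.fill (W.fill t₅)) (hj : us j = D.fill (.node f ts))
    (hb : ((K.comp ((Ctx.around g us j).comp D)).yield lex).count (.core .b) = 0)
    (hc : ((K.comp ((Ctx.around g us j).comp D)).yield lex).count (.core .c) = 0) :
    HasSpread lex l ((K.comp ((Ctx.around g us i).comp C)).fill (V.fill t₅)) := by
  have hzero : ∀ x, ((K.comp ((Ctx.around g us j).comp D)).yield lex).count (.core x) = 0 →
      ((us i).yield lex).count (.core x) = 0 := fun x hx => by
    have := Ctx.count_yield_le_around lex (.core x) g us hij.symm
    simp only [Ctx.count_yield_comp] at hx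
    omega
  have heq : ∀ x, ((C.fill (V.fill t₅)).yield lex).count (.core x) =
      ((us i).yield lex).count (.core x) := by
    rw [hi] at hzero ⊢
    exact hVW.count_fill_eq (.inr (hzero .c hc)) (.inl (hzero .b hb))
  refine ⟨K.comp ((Ctx.around g (Function.update us i (C.fill (V.fill t₅))) j).comp D), f, ts,
    ?_, ?_, ?_, hs⟩
  · rw [Ctx.fill_comp, Ctx.around_comp_fill, Ctx.fill_comp K, Ctx.fill_comp, ← hj,
      ← Function.update_of_ne hij.symm (C.fill (V.fill t₅)) us, Ctx.around_fill_self]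
  · simpa only [Ctx.count_yield_comp, Ctx.count_yield_around_update (heq _) hij] using hb
  · simpa only [Ctx.count_yield_comp, Ctx.count_yield_around_update (heq _) hij] using hc

theorem HasSpread.shrink (h : HasSpread lex l (C₁.fill (W.fill t₅))) (hVW : Shrinks lex l W V) :
    HasSpread lex l (C₁.fill (V.fill t₅)) := by
  obtain ⟨D, f, ts, heq, hb, hc, hs⟩ := h
  obtain ⟨E, rfl, hE⟩ | ⟨E, rfl, hE⟩ | ⟨K, g, us, i, j, C, D, hij, rfl, rfl, hi, hj⟩ :=
    Ctx.nested_or_diverging_of_fill_eq heq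
  · exact hs.hasSpread_of_above hVW hE hb hc
  · obtain rfl | ⟨i, E, rfl, hi⟩ := Ctx.eq_around_comp_of_fill_eq_node hE.symm
    · exact hs.hasSpread_of_above (D := .hole) hVW hE.symm (by simpa only [Ctx.comp_hole])
        (by simpa only [Ctx.comp_hole])
    · exact hs.hasSpread_of_below hVW hi hb hc
  · exact hs.hasSpread_of_beside hVW hij hi hj hb hc

theorem HasSpread.exists_lt_count_a {t : Tree S} (h : HasSpread lex l t)
    (hb : 0 < (t.yield lex).count (.core .b)) :
    ∃ (E : Ctx S) (u : Tree S), t = E.fill u ∧ l < (E.yield lex).count (.core .a) := by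
  obtain ⟨D, f, ts, rfl, -, -, hs⟩ := h
  obtain ⟨E, u, hE, hu⟩ := exists_leaf_of_count_pos lex (x := .core .a) (by decide) _ hb
  refine ⟨E, u, hE, ?_⟩
  have hcount := congrArg (fun s => (s.yield lex).count (.core .a)) hE
  simp only [Ctx.count_yield_fill, hu] at hcount
  have := hs.lt_a
  omega

theorem IsPumpingDecomposition.shrinks {T : Set (Tree S)} {p : ℕ} {t : Tree S}
    {C₁ C₂ C₃ C₄ : Ctx S} (hd : IsPumpingDecomposition T p t C₁ C₂ C₃ C₄ t₅) (ht : t ∈ T)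
    (hT : ∀ t ∈ T, t.yield lex ∈ CSDStrings)
    (hl : ∀ C : Ctx S, C.height ≤ p → (C.yield lex).length ≤ l) :
    Shrinks lex l (C₂.comp (C₃.comp C₄)) C₃ := by
  obtain ⟨rfl, hheight, -, hpump⟩ := hd
  have hac := count_a_eq_count_c (hT _ ht)
  have hbd := count_b_eq_count_d (hT _ ht)
  have hac₀ := count_a_eq_count_c (hT _ (hpump 0))
  have hbd₀ := count_b_eq_count_d (hT _ (hpump 0))
  simp only [pump, Ctx.count_yield_fill] at hac hbd hac₀ hbd₀
  refine ⟨fun x => List.count_le_length.trans (hl _ hheight), fun x => ?_, ?_, ?_⟩ <;>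
    simp only [Ctx.count_yield_comp] <;> omega

theorem IsPumpingDecomposition.size_lt {T : Set (Tree S)} {p : ℕ} {t : Tree S}
    {C₁ C₂ C₃ C₄ : Ctx S} (hd : IsPumpingDecomposition T p t C₁ C₂ C₃ C₄ t₅) :
    (C₁.fill (C₃.fill t₅)).size < t.size := by
  obtain ⟨rfl, -, hpos, -⟩ := hd
  simp only [Ctx.size_fill]
  obtain h | h := Nat.add_pos_iff_pos_or_pos.1 hpos <;> have := Ctx.size_pos h <;> omega

theorem IsPumpingHeight.not_hasSpread {T : Set (Tree S)} {p : ℕ} (hp : IsPumpingHeight T p)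
    (hT : ∀ t ∈ T, t.yield lex ∈ CSDStrings)
    (hl : ∀ C : Ctx S, C.height ≤ p → (C.yield lex).length ≤ l) {t : Tree S} (ht : t ∈ T) :
    ¬ HasSpread lex l t := by
  induction hn : t.size using Nat.strong_induction_on generalizing t with
  | _ n ih =>
  subst hn
  intro hspread
  obtain hle | hlt := le_or_gt t.height p
  · obtain ⟨E, u, rfl, ha⟩ := hspread.exists_lt_count_a (count_core_pos (hT t ht) .b)
    exact (ha.trans_le List.count_le_length).not_ge (hl E ((E.height_le_height_fill u).trans hle))
  · obtain ⟨C₁, C₂, C₃, C₄, t₅, hd⟩ := hp t ht hlt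
    refine ih _ hd.size_lt (hd.2.2.2 0) rfl (HasSpread.shrink ?_ (hd.shrinks ht hT hl))
    simpa only [Ctx.fill_comp, ← hd.1] using hspread

theorem IsPumpingHeight.isSeparated {T : Set (Tree S)} {p : ℕ} (hp : IsPumpingHeight T p)
    (hT : ∀ t ∈ T, t.yield lex ∈ CSDStrings)
    (hl : ∀ C : Ctx S, C.height ≤ p → (C.yield lex).length ≤ l) {t : Tree S} (ht : t ∈ T) :
    IsSeparated lex .a .c l t ∨ IsSeparated lex .d .b l t := by
  by_contra! hsep
  exact hp.not_hasSpread hT hl ht (hasSpread_of_not_isSeparated (hT t ht) hsep.1 hsep.2)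

end Separation

/-! ### Big-step derivations -/

/-- Trees and contexts as one type, so that the derivations of both from a grammar form a single
inductive relation. -/
inductive Form (S : Signature) : Type
  | tree (t : Tree S)
  | ctx (C : Ctx S)

/-- The tree obtained by filling the hole of a form; a tree has no hole and ignores the
argument. -/
def Form.fill : Form S → Tree S → Tree S
  | .tree t, _ => t
  | .ctx C, u => C.fill u

open Relation (ReflTransGen)

namespace LMCFTG

/-- The signature of the sentential forms of a grammar. -/
abbrev sig (G : LMCFTG S) : Signature := S.extend G.N₀ G.N₁

/-- Big-step derivation of a terminal form from a sentential form. Since rewriting is context-free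
and linear, the parts of a sentential form derive independently of each other. -/
inductive Derives (G : LMCFTG S) : Form G.sig → Form S → Prop
  | tree_terminal {f : S.Sym} {us : Fin (S.rank f) → Tree G.sig} {ts : Fin (S.rank f) → Tree S}
      (h : ∀ j, G.Derives (.tree (us j)) (.tree (ts j))) :
      G.Derives (.tree (.node (S := G.sig) (Sum.inr f) us)) (.tree (.node f ts))
  | tree_nt₀ {A : G.N₀} {us : Fin 0 → Tree G.sig} {r : Tree G.sig} {t : Tree S}
      (hr : (A, r) ∈ G.rules₀) (h : G.Derives (.tree r) (.tree t)) :
      G.Derives (.tree (.node (S := G.sig) (Sum.inl (Sum.inl A)) us)) (.tree t)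
  | tree_nt₁ {A : G.N₁} {us : Fin 1 → Tree G.sig} {R : Ctx G.sig} {C : Ctx S} {t : Tree S}
      (hR : (A, R) ∈ G.rules₁) (hC : G.Derives (.ctx R) (.ctx C))
      (ht : G.Derives (.tree (us 0)) (.tree t)) :
      G.Derives (.tree (.node (S := G.sig) (Sum.inl (Sum.inr A)) us)) (.tree (C.fill t))
  | hole : G.Derives (.ctx .hole) (.ctx .hole)
  | ctx_terminal {f : S.Sym} {i : Fin (S.rank f)} {us : {j : Fin (S.rank f) // j ≠ i} → Tree G.sig}
      {ts : {j : Fin (S.rank f) // j ≠ i} → Tree S} {K : Ctx G.sig} {C : Ctx S}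
      (h : ∀ j, G.Derives (.tree (us j)) (.tree (ts j))) (hC : G.Derives (.ctx K) (.ctx C)) :
      G.Derives (.ctx (.node (S := G.sig) (Sum.inr f) i us K)) (.ctx (.node f i ts C))
  | ctx_nt₁ {A : G.N₁} {i : Fin 1} {us : {j : Fin 1 // j ≠ i} → Tree G.sig} {R K : Ctx G.sig}
      {C D : Ctx S} (hR : (A, R) ∈ G.rules₁) (hC : G.Derives (.ctx R) (.ctx C))
      (hD : G.Derives (.ctx K) (.ctx D)) :
      G.Derives (.ctx (.node (S := G.sig) (Sum.inl (Sum.inr A)) i us K)) (.ctx (C.comp D))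

variable {G : LMCFTG S}

theorem derives_lift (t : Tree S) : G.Derives (.tree (t.lift G.N₀ G.N₁)) (.tree t) := by
  induction t with
  | node f ts ih => exact .tree_terminal ih

theorem Derives.node_congr {f : G.sig.Sym} {us us' : Fin (G.sig.rank f) → Tree G.sig} {t : Tree S}
    (hu : ∀ j u, G.Derives (.tree (us j)) (.tree u) → G.Derives (.tree (us' j)) (.tree u))
    (h : G.Derives (.tree (.node f us)) (.tree t)) :
    G.Derives (.tree (.node f us')) (.tree t) := by
  cases h with
  | tree_terminal h => exact .tree_terminal fun j => hu j _ (h j)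
  | tree_nt₀ hr h => exact .tree_nt₀ hr h
  | tree_nt₁ hR hC h => exact .tree_nt₁ hR hC (hu (0 : Fin 1) _ h)

theorem Derives.fill_mono {r r' : Tree G.sig}
    (hr : ∀ t, G.Derives (.tree r) (.tree t) → G.Derives (.tree r') (.tree t)) (K : Ctx G.sig)
    {t : Tree S} (h : G.Derives (.tree (K.fill r)) (.tree t)) :
    G.Derives (.tree (K.fill r')) (.tree t) := by
  induction K generalizing t with
  | hole => exact hr t h
  | node f i us K ih =>
    refine node_congr (fun j u hu => ?_) h
    split_ifs at hu ⊢
    · exact ih hu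
    · exact hu

theorem Derives.split_child {f : G.sig.Sym} {us : Fin (G.sig.rank f) → Tree G.sig} {t : Tree S}
    (h : G.Derives (.tree (.node f us)) (.tree t)) (i : Fin (G.sig.rank f)) :
    ∃ (C : Ctx S) (u : Tree S), G.Derives (.tree (us i)) (.tree u) ∧ t = C.fill u ∧
      ∀ K D, G.Derives (.ctx K) (.ctx D) →
        G.Derives (.ctx (.node f i (fun j => us j.1) K)) (.ctx (C.comp D)) := by
  cases h with
  | @tree_terminal f _ ts h =>
    exact ⟨Ctx.around f ts i, ts i, h i, (Ctx.around_fill_self f ts i).symm,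
      fun K D hD => .ctx_terminal (fun j => h j.1) hD⟩
  | tree_nt₀ => exact Fin.elim0 i
  | @tree_nt₁ _ _ _ C u hR hC h =>
    obtain rfl : i = (0 : Fin 1) := Subsingleton.elim (α := Fin 1) _ _
    exact ⟨C, u, h, rfl, fun K D hD => .ctx_nt₁ hR hC hD⟩

theorem Derives.exists_of_fill {R : Ctx G.sig} {s : Tree G.sig} {t : Tree S}
    (h : G.Derives (.tree (R.fill s)) (.tree t)) :
    ∃ C u, G.Derives (.ctx R) (.ctx C) ∧ G.Derives (.tree s) (.tree u) ∧ t = C.fill u := by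
  induction R generalizing t with
  | hole => exact ⟨.hole, t, .hole, h, rfl⟩
  | node f i us K ih =>
    obtain ⟨C, u, hu, rfl, hC⟩ := split_child h i
    rw [dif_pos rfl] at hu
    obtain ⟨D, v, hD, hv, rfl⟩ := ih hu
    refine ⟨C.comp D, v, ?_, hv, (Ctx.fill_comp C D v).symm⟩
    have hside : (fun j : {j // j ≠ i} => if hj : j.1 = i then K.fill s else us ⟨j.1, hj⟩) = us :=
      funext fun j => dif_neg j.2
    exact hside ▸ hC K D hD

theorem Derives.of_step {s s' : Tree G.sig} (h : G.Step s s') {t : Tree S}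
    (ht : G.Derives (.tree s') (.tree t)) : G.Derives (.tree s) (.tree t) := by
  cases h with
  | expand₀ K A r hr => exact fill_mono (fun _ h => .tree_nt₀ hr h) K ht
  | expand₁ K A R hR s =>
    refine fill_mono (fun t h => ?_) K ht
    obtain ⟨C, u, hC, hu, rfl⟩ := exists_of_fill h
    exact .tree_nt₁ hR hC hu

theorem step_fill (K : Ctx G.sig) {s s' : Tree G.sig} (h : G.Step s s') :
    G.Step (K.fill s) (K.fill s') := by
  cases h with
  | expand₀ K' A r hr =>
    rw [← Ctx.fill_comp, ← Ctx.fill_comp]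
    exact .expand₀ _ A r hr
  | expand₁ K' A R hR s =>
    rw [← Ctx.fill_comp, ← Ctx.fill_comp]
    exact .expand₁ _ A R hR s

theorem steps_node (f : G.sig.Sym) {us us' : Fin (G.sig.rank f) → Tree G.sig}
    (h : ∀ j, ReflTransGen G.Step (us j) (us' j)) :
    ReflTransGen G.Step (.node f us) (.node f us') := by
  suffices H : ∀ A : Finset (Fin (G.sig.rank f)),
      ReflTransGen G.Step (.node f us) (.node f (A.piecewise us' us)) by
    simpa only [Finset.piecewise_univ] using H Finset.univ
  intro A
  induction A using Finset.induction_on with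
  | empty => rw [Finset.piecewise_empty]
  | insert j A hj ih =>
    have hold : Function.update (A.piecewise us' us) j (us j) = A.piecewise us' us := by
      rw [Function.update_eq_self_iff, Finset.piecewise_eq_of_notMem _ _ _ hj]
    have hstep : ReflTransGen G.Step ((Ctx.around f (A.piecewise us' us) j).fill (us j))
        ((Ctx.around f (A.piecewise us' us) j).fill (us' j)) :=
      ReflTransGen.lift (fun s => Ctx.fill _ s) (fun _ _ => step_fill _) _ _ (h j)
    rw [Ctx.around_fill, Ctx.around_fill, ← Finset.piecewise_insert, hold] at hstep
    exact ih.trans hstep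

theorem node_eq_nt₁ (A : G.N₁) (us : Fin 1 → Tree G.sig) :
    Tree.node (S := G.sig) (Sum.inl (Sum.inr A)) us = Tree.nt₁ A (us 0) := by
  unfold Tree.nt₁
  congr 1
  funext j
  rw [Subsingleton.elim (α := Fin 1) j 0]

theorem ctx_node_fill_eq_nt₁ (A : G.N₁) (i : Fin 1) (us : {j : Fin 1 // j ≠ i} → Tree G.sig)
    (K : Ctx G.sig) (s : Tree G.sig) :
    (Ctx.node (S := G.sig) (Sum.inl (Sum.inr A)) i us K).fill s = Tree.nt₁ A (K.fill s) :=
  (node_eq_nt₁ A _).trans (congrArg _ (dif_pos (Subsingleton.elim (α := Fin 1) _ _)))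

theorem Derives.steps {q : Form G.sig} {v : Form S} (h : G.Derives q v) {s : Tree G.sig}
    {u : Tree S} (hs : ReflTransGen G.Step s (u.lift G.N₀ G.N₁)) :
    ReflTransGen G.Step (q.fill s) ((v.fill u).lift G.N₀ G.N₁) := by
  induction h generalizing s u with
  | tree_terminal _ ih => exact steps_node (Sum.inr _) fun j => ih j hs
  | @tree_nt₀ A us r t hr _ ih =>
    obtain rfl : us = Fin.elim0 := Subsingleton.elim _ _
    exact .head (.expand₀ .hole A r hr) (ih hs)
  | @tree_nt₁ A us R C t hR _ _ ihC iht =>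
    rw [Form.fill, node_eq_nt₁]
    exact .head (.expand₁ .hole A R hR (us 0)) (ihC (iht hs))
  | hole => exact hs
  | @ctx_terminal f i us ts K C _ _ ih ihC =>
    have hchild (j : Fin (S.rank f)) : ReflTransGen G.Step
        (if hj : j = i then K.fill s else us ⟨j, hj⟩)
        ((if hj : j = i then C.fill u else ts ⟨j, hj⟩ : Tree S).lift G.N₀ G.N₁) := by
      by_cases hj : j = i
      · rw [dif_pos hj, dif_pos hj]
        exact ihC hs
      · rw [dif_neg hj, dif_neg hj]
        exact ih _ hs
    exact steps_node (Sum.inr f) hchild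
  | @ctx_nt₁ A i us R K C D hR _ _ ihC ihD =>
    rw [Form.fill, Form.fill, Ctx.fill_comp, ctx_node_fill_eq_nt₁]
    exact .head (.expand₁ .hole A R hR _) (ihC (ihD hs))

theorem mem_language_iff {t : Tree S} :
    t ∈ G.language ↔ G.Derives (.tree (.nt₀ S G.N₁ G.start)) (.tree t) := by
  refine ⟨fun h => ?_, fun h => h.steps (u := t) .refl⟩
  refine ReflTransGen.head_induction_on (motive := fun s _ => G.Derives (.tree s) (.tree t)) h
    (derives_lift t) fun hstep _ ih => .of_step hstep ih

end LMCFTG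

/-! ### Recurrences in derivations -/

/-- Twice the height, plus one for a tree. Thus weights decrease weakly from a form to its parts,
and strictly from a context to the trees beside the path to its hole. -/
def Form.weight : Form S → ℕ
  | .tree t => 2 * t.height + 1
  | .ctx C => 2 * C.height

section Weight

variable {b : ℕ} {f : S.Sym} {C D : Ctx S}

theorem Form.weight_node_le {ts : Fin (S.rank f) → Tree S}
    (h : ∀ j, (Form.tree (ts j)).weight ≤ b) : (Form.tree (.node f ts)).weight ≤ 2 * b + 3 := by
  simp only [weight] at *
  have : (Tree.node f ts).height ≤ b / 2 + 1 :=
    Tree.height_node_le_succ_iff.2 fun j => by have := h j; omega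
  omega

theorem Form.weight_ctx_node_le {i : Fin (S.rank f)} {ts : {j : Fin (S.rank f) // j ≠ i} → Tree S}
    (h : ∀ j, (Form.tree (ts j)).weight ≤ b) (hC : (Form.ctx C).weight ≤ b) :
    (Form.ctx (.node f i ts C)).weight ≤ 2 * b + 3 := by
  simp only [weight] at *
  have : (Ctx.node f i ts C).height ≤ b / 2 + 1 :=
    Ctx.height_node_le_succ_iff.2 ⟨fun j => by have := h j; omega, by omega⟩
  omega

theorem Form.weight_fill_le {t : Tree S} (hC : (Form.ctx C).weight ≤ b)
    (ht : (Form.tree t).weight ≤ b) : (Form.tree (C.fill t)).weight ≤ 2 * b + 3 := by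
  have := C.height_fill_le t
  simp only [weight] at *
  omega

theorem Form.weight_comp_le (hC : (Form.ctx C).weight ≤ b) (hD : (Form.ctx D).weight ≤ b) :
    (Form.ctx (C.comp D)).weight ≤ 2 * b + 3 := by
  have := C.height_comp_le D
  simp only [weight] at *
  omega

end Weight

/-- `q.Part q'`: the form `q'` is an immediate constituent of `q`. -/
inductive Form.Part : Form S → Form S → Prop
  | child {f : S.Sym} {ts : Fin (S.rank f) → Tree S} (j : Fin (S.rank f)) :
      Part (.tree (.node f ts)) (.tree (ts j))
  | side {f : S.Sym} {i : Fin (S.rank f)} {us : {j : Fin (S.rank f) // j ≠ i} → Tree S} {C : Ctx S}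
      (j : {j : Fin (S.rank f) // j ≠ i}) : Part (.ctx (.node f i us C)) (.tree (us j))
  | spine {f : S.Sym} {i : Fin (S.rank f)} {us : {j : Fin (S.rank f) // j ≠ i} → Tree S}
      {C : Ctx S} : Part (.ctx (.node f i us C)) (.ctx C)

theorem Form.finite_parts_tree (t : Tree S) :
    {q | ReflTransGen Form.Part (.tree t) q}.Finite := by
  induction t with
  | node f ts ih =>
    refine ((Set.finite_iUnion ih).insert (.tree (.node f ts))).subset fun q hq => ?_
    obtain rfl | ⟨_, ⟨j⟩, hq⟩ := hq.cases_head
    · exact .inl rfl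
    · exact .inr (Set.mem_iUnion.2 ⟨j, hq⟩)

theorem Form.finite_parts (q : Form S) : {q' | ReflTransGen Form.Part q q'}.Finite := by
  obtain t | C := q
  · exact finite_parts_tree t
  induction C with
  | hole =>
    refine (Set.finite_singleton (.ctx .hole)).subset fun q hq => ?_
    obtain rfl | ⟨_, ⟨⟩, _⟩ := hq.cases_head
    rfl
  | node f i us C ih =>
    refine (((Set.finite_iUnion fun j => finite_parts_tree (us j)).union ih).insert
      (.ctx (.node f i us C))).subset fun q hq => ?_
    obtain rfl | ⟨_, hpart, hq⟩ := hq.cases_head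
    · exact .inl rfl
    · cases hpart with
      | side j => exact .inr (.inl (Set.mem_iUnion.2 ⟨j, hq⟩))
      | spine => exact .inr (.inr hq)

namespace LMCFTG

variable {G : LMCFTG S}

/-- The constituents of the start form and of the right-hand sides of the rules; these are the
forms that occur in derivations from the start symbol. -/
def states (G : LMCFTG S) : Set (Form G.sig) :=
  ⋃ q₀ ∈ insert (.tree (.nt₀ S G.N₁ G.start))
    ((fun r => .tree r.2) '' G.rules₀ ∪ (fun r => .ctx r.2) '' G.rules₁),
    {q | ReflTransGen Form.Part q₀ q}

theorem finite_states (G : LMCFTG S) : G.states.Finite :=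
  (((G.finite_rules₀.image _).union (G.finite_rules₁.image _)).insert _).biUnion
    fun q _ => q.finite_parts

theorem start_mem_states : .tree (.nt₀ S G.N₁ G.start) ∈ G.states :=
  Set.mem_biUnion (.inl rfl) .refl

theorem mem_states_of_rules₀ {A : G.N₀} {r : Tree G.sig} (hr : (A, r) ∈ G.rules₀) :
    .tree r ∈ G.states :=
  Set.mem_biUnion (.inr (.inl ⟨_, hr, rfl⟩)) .refl

theorem mem_states_of_rules₁ {A : G.N₁} {R : Ctx G.sig} (hR : (A, R) ∈ G.rules₁) :
    .ctx R ∈ G.states :=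
  Set.mem_biUnion (.inr (.inr ⟨_, hR, rfl⟩)) .refl

theorem mem_states_of_part {q q' : Form G.sig} (hq : q ∈ G.states) (h : q.Part q') :
    q' ∈ G.states := by
  obtain ⟨q₀, hq₀, hq⟩ := Set.mem_iUnion₂.1 hq
  exact Set.mem_biUnion hq₀ (hq.tail h)

/-- A derivation of `v'` from `q'` occurs in a derivation of `v` from `q` and can be replaced there
by any other derivation from `q'`. If `v` is a context, the surroundings `E u` and `e u` of the
occurrence depend on the tree `u` in the hole of `v`, because the hole may lie beside the
occurrence. -/
structure Contains (G : LMCFTG S) (q : Form G.sig) (v : Form S) (q' : Form G.sig) (v' : Form S) :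
    Prop where
  mem_states : q' ∈ G.states
  derives : G.Derives q' v'
  weight_le : v'.weight ≤ v.weight
  exists_surroundings : ∃ (E : Tree S → Ctx S) (e : Tree S → Tree S),
    (∀ u, v.fill u = (E u).fill (v'.fill (e u))) ∧
      ∀ w', G.Derives q' w' → ∃ w, G.Derives q w ∧ ∀ u, w.fill u = (E u).fill (w'.fill (e u))

/-- A derivation of the context `C'` from `R'` occurs in a derivation of the context `C` from `R`,
on the path to the hole, and can be replaced there by any other derivation from `R'`. -/
structure SpineContains (G : LMCFTG S) (R : Ctx G.sig) (C : Ctx S) (R' : Ctx G.sig) (C' : Ctx S) :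
    Prop where
  mem_states : .ctx R' ∈ G.states
  derives : G.Derives (.ctx R') (.ctx C')
  exists_surroundings : ∃ E F : Ctx S, C = E.comp (C'.comp F) ∧
    ∀ D, G.Derives (.ctx R') (.ctx D) → G.Derives (.ctx R) (.ctx (E.comp (D.comp F)))

theorem Derives.exists_eq_tree {s : Tree G.sig} {v : Form S} (h : G.Derives (.tree s) v) :
    ∃ t, v = .tree t := by
  cases h <;> exact ⟨_, rfl⟩

theorem Derives.exists_eq_ctx {R : Ctx G.sig} {v : Form S} (h : G.Derives (.ctx R) v) :
    ∃ C, v = .ctx C := by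
  cases h <;> exact ⟨_, rfl⟩

section Contains

variable {q q' q'' : Form G.sig} {v v' v'' : Form S} {R R' R'' : Ctx G.sig} {C C' C'' : Ctx S}

theorem Contains.refl (hq : q ∈ G.states) (h : G.Derives q v) : G.Contains q v q v :=
  ⟨hq, h, le_rfl, fun _ => .hole, id, fun _ => rfl, fun w hw => ⟨w, hw, fun _ => rfl⟩⟩

theorem Contains.trans (h : G.Contains q v q' v') (h' : G.Contains q' v' q'' v'') :
    G.Contains q v q'' v'' := by
  obtain ⟨E, e, hv, hE⟩ := h.exists_surroundings
  obtain ⟨E', e', hv', hE'⟩ := h'.exists_surroundings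
  refine ⟨h'.mem_states, h'.derives, h'.weight_le.trans h.weight_le,
    fun u => (E u).comp (E' (e u)), e' ∘ e, fun u => ?_, fun w'' hw'' => ?_⟩
  · rw [hv, hv', Ctx.fill_comp, Function.comp_apply]
  · obtain ⟨w', hw', hw'E⟩ := hE' w'' hw''
    obtain ⟨w, hw, hwE⟩ := hE w' hw'
    exact ⟨w, hw, fun u => by rw [hwE, hw'E, Ctx.fill_comp, Function.comp_apply]⟩

theorem SpineContains.refl (hR : .ctx R ∈ G.states) (h : G.Derives (.ctx R) (.ctx C)) :
    G.SpineContains R C R C :=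
  ⟨hR, h, .hole, .hole, (Ctx.comp_hole C).symm, fun D hD => by rwa [Ctx.comp_hole]⟩

theorem SpineContains.trans (h : G.SpineContains R C R' C') (h' : G.SpineContains R' C' R'' C'') :
    G.SpineContains R C R'' C'' := by
  obtain ⟨E, F, rfl, hE⟩ := h.exists_surroundings
  obtain ⟨E', F', rfl, hE'⟩ := h'.exists_surroundings
  refine ⟨h'.mem_states, h'.derives, E.comp E', F'.comp F, by simp only [Ctx.comp_assoc],
    fun D hD => ?_⟩
  simpa only [Ctx.comp_assoc] using hE _ (hE' D hD)

theorem SpineContains.contains (h : G.SpineContains R C R' C') :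
    G.Contains (.ctx R) (.ctx C) (.ctx R') (.ctx C') := by
  obtain ⟨E, F, rfl, hE⟩ := h.exists_surroundings
  refine ⟨h.mem_states, h.derives, ?_, fun _ => E, F.fill, fun u => ?_, fun w hw => ?_⟩
  · exact Nat.mul_le_mul_left 2 <| (Ctx.height_outer_le_height_comp C' F).trans
      (Ctx.height_inner_le_height_comp E _)
  · simp only [Form.fill, Ctx.fill_comp]
  · obtain ⟨D, rfl⟩ := hw.exists_eq_ctx
    exact ⟨_, hE D hw, fun u => by simp only [Form.fill, Ctx.fill_comp]⟩

end Contains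

/-- One derivation occurs in another one, where an occurrence of a context in a context has to lie
on the path to the hole. -/
inductive Component (G : LMCFTG S) : Form G.sig → Form S → Form G.sig → Form S → Prop
  | of_tree {s : Tree G.sig} {t : Tree S} {q : Form G.sig} {v : Form S}
      (h : G.Contains (.tree s) (.tree t) q v) : G.Component (.tree s) (.tree t) q v
  | side {R : Ctx G.sig} {C : Ctx S} {s : Tree G.sig} {t : Tree S}
      (h : G.Contains (.ctx R) (.ctx C) (.tree s) (.tree t)) :
      G.Component (.ctx R) (.ctx C) (.tree s) (.tree t)
  | spine {R R' : Ctx G.sig} {C C' : Ctx S} (h : G.SpineContains R C R' C') :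
      G.Component (.ctx R) (.ctx C) (.ctx R') (.ctx C')

theorem Component.contains {q q' : Form G.sig} {v v' : Form S} (h : G.Component q v q' v') :
    G.Contains q v q' v' := by
  cases h with
  | of_tree h => exact h
  | side h => exact h
  | spine h => exact h.contains

section Constituents

variable {f : S.Sym} {i : Fin (S.rank f)} {A : G.N₁} {R K : Ctx G.sig} {C D : Ctx S}

theorem component_child {us : Fin (S.rank f) → Tree G.sig} {ts : Fin (S.rank f) → Tree S}
    (hq : .tree (.node (S := G.sig) (Sum.inr f) us) ∈ G.states)
    (h : ∀ j, G.Derives (.tree (us j)) (.tree (ts j))) (j : Fin (S.rank f)) :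
    G.Component (.tree (.node (S := G.sig) (Sum.inr f) us)) (.tree (.node f ts))
      (.tree (us j)) (.tree (ts j)) := by
  refine .of_tree ⟨mem_states_of_part hq (.child (S := G.sig) (f := Sum.inr f) j), h j, ?_,
    fun _ => Ctx.around f ts j, id, fun _ => (Ctx.around_fill_self f ts j).symm, fun w hw => ?_⟩
  · have := Tree.height_child_lt ts j
    simp only [Form.weight]
    omega
  · obtain ⟨t, rfl⟩ := hw.exists_eq_tree
    refine ⟨.tree (.node f (Function.update ts j t)), .tree_terminal fun l => ?_,
      fun _ => (Ctx.around_fill f ts j t).symm⟩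
    obtain rfl | hl := eq_or_ne l j
    · rwa [Function.update_self]
    · rw [Function.update_of_ne hl]
      exact h l

theorem component_rules₀ {A : G.N₀} {us : Fin 0 → Tree G.sig} {r : Tree G.sig} {t : Tree S}
    (hr : (A, r) ∈ G.rules₀) (h : G.Derives (.tree r) (.tree t)) :
    G.Component (.tree (.node (S := G.sig) (Sum.inl (Sum.inl A)) us)) (.tree t)
      (.tree r) (.tree t) := by
  refine .of_tree ⟨mem_states_of_rules₀ hr, h, le_rfl, fun _ => .hole, id, fun _ => rfl,
    fun w hw => ?_⟩
  obtain ⟨t', rfl⟩ := hw.exists_eq_tree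
  exact ⟨_, .tree_nt₀ hr hw, fun _ => rfl⟩

theorem component_argument {us : Fin 1 → Tree G.sig} {t : Tree S}
    (hq : .tree (.node (S := G.sig) (Sum.inl (Sum.inr A)) us) ∈ G.states) (hR : (A, R) ∈ G.rules₁)
    (hC : G.Derives (.ctx R) (.ctx C)) (ht : G.Derives (.tree (us 0)) (.tree t)) :
    G.Component (.tree (.node (S := G.sig) (Sum.inl (Sum.inr A)) us)) (.tree (C.fill t))
      (.tree (us 0)) (.tree t) := by
  refine .of_tree ⟨mem_states_of_part hq
    (.child (S := G.sig) (f := Sum.inl (Sum.inr A)) (0 : Fin 1)), ht, ?_, fun _ => C, id,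
    fun _ => rfl, fun w hw => ?_⟩
  · have := Tree.height_le_height_fill C t
    simp only [Form.weight]
    omega
  · obtain ⟨t', rfl⟩ := hw.exists_eq_tree
    exact ⟨_, .tree_nt₁ hR hC hw, fun _ => rfl⟩

theorem component_tree_rules₁ {us : Fin 1 → Tree G.sig} {t : Tree S} (hR : (A, R) ∈ G.rules₁)
    (hC : G.Derives (.ctx R) (.ctx C)) (ht : G.Derives (.tree (us 0)) (.tree t)) :
    G.Component (.tree (.node (S := G.sig) (Sum.inl (Sum.inr A)) us)) (.tree (C.fill t))
      (.ctx R) (.ctx C) := by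
  refine .of_tree ⟨mem_states_of_rules₁ hR, hC, ?_, fun _ => .hole, fun _ => t, fun _ => rfl,
    fun w hw => ?_⟩
  · have := Ctx.height_le_height_fill C t
    simp only [Form.weight]
    omega
  · obtain ⟨D, rfl⟩ := hw.exists_eq_ctx
    exact ⟨_, .tree_nt₁ hR hw ht, fun _ => rfl⟩

theorem component_side {us : {j : Fin (S.rank f) // j ≠ i} → Tree G.sig}
    {ts : {j : Fin (S.rank f) // j ≠ i} → Tree S}
    (hq : .ctx (.node (S := G.sig) (Sum.inr f) i us K) ∈ G.states)
    (h : ∀ j, G.Derives (.tree (us j)) (.tree (ts j))) (hC : G.Derives (.ctx K) (.ctx C))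
    (j : {j : Fin (S.rank f) // j ≠ i}) :
    G.Component (.ctx (.node (S := G.sig) (Sum.inr f) i us K)) (.ctx (.node f i ts C))
      (.tree (us j)) (.tree (ts j)) := by
  have hfill (u t : Tree S) :
      (Ctx.node f i (Function.update ts j t) C).fill u = (Ctx.around f
        (fun l => if hl : l = i then C.fill u else ts ⟨l, hl⟩) j).fill t := by
    rw [Ctx.around_fill, Ctx.fill]
    congr 1
    funext l
    obtain rfl | hl := eq_or_ne l j.1
    · rw [dif_neg j.2, Function.update_self, Function.update_self]
    · rw [Function.update_of_ne hl]
      refine dite_congr rfl (fun _ => rfl) fun _ => Function.update_of_ne ?_ _ _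
      exact fun e => hl (congrArg Subtype.val e)
  refine .side ⟨mem_states_of_part hq (.side (S := G.sig) (f := Sum.inr f) j), h j, ?_, _, id,
    fun u => (congrArg (fun ts => (Ctx.node f i ts C).fill u)
      (Function.update_eq_self j ts).symm).trans (hfill u (ts j)), fun w hw => ?_⟩
  · have := Ctx.height_side_lt ts C j
    simp only [Form.weight]
    omega
  · obtain ⟨t, rfl⟩ := hw.exists_eq_tree
    refine ⟨.ctx _, .ctx_terminal (fun l => ?_) hC, fun u => hfill u t⟩
    obtain rfl | hl := eq_or_ne l j
    · rwa [Function.update_self]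
    · rw [Function.update_of_ne hl]
      exact h l

theorem component_spine {us : {j : Fin (S.rank f) // j ≠ i} → Tree G.sig}
    {ts : {j : Fin (S.rank f) // j ≠ i} → Tree S}
    (hq : .ctx (.node (S := G.sig) (Sum.inr f) i us K) ∈ G.states)
    (h : ∀ j, G.Derives (.tree (us j)) (.tree (ts j))) (hC : G.Derives (.ctx K) (.ctx C)) :
    G.Component (.ctx (.node (S := G.sig) (Sum.inr f) i us K)) (.ctx (.node f i ts C))
      (.ctx K) (.ctx C) := by
  refine .spine ⟨mem_states_of_part hq .spine, hC, .node f i ts .hole, .hole, ?_, fun D hD => ?_⟩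
  · simp only [Ctx.comp, Ctx.comp_hole]
  · simpa only [Ctx.comp, Ctx.comp_hole] using .ctx_terminal h hD

theorem component_ctx_rules₁ {i : Fin 1} {us : {j : Fin 1 // j ≠ i} → Tree G.sig}
    (hR : (A, R) ∈ G.rules₁) (hC : G.Derives (.ctx R) (.ctx C)) (hD : G.Derives (.ctx K) (.ctx D)) :
    G.Component (.ctx (.node (S := G.sig) (Sum.inl (Sum.inr A)) i us K)) (.ctx (C.comp D))
      (.ctx R) (.ctx C) :=
  .spine ⟨mem_states_of_rules₁ hR, hC, .hole, D, rfl, fun C' hC' => .ctx_nt₁ (C := C') hR hC' hD⟩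

theorem component_ctx_argument {i : Fin 1} {us : {j : Fin 1 // j ≠ i} → Tree G.sig}
    (hq : .ctx (.node (S := G.sig) (Sum.inl (Sum.inr A)) i us K) ∈ G.states)
    (hR : (A, R) ∈ G.rules₁) (hC : G.Derives (.ctx R) (.ctx C)) (hD : G.Derives (.ctx K) (.ctx D)) :
    G.Component (.ctx (.node (S := G.sig) (Sum.inl (Sum.inr A)) i us K)) (.ctx (C.comp D))
      (.ctx K) (.ctx D) := by
  refine .spine ⟨mem_states_of_part hq .spine, hD, C, .hole, ?_, fun D' hD' => ?_⟩
  · rw [Ctx.comp_hole]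
  · rw [Ctx.comp_hole]
    exact .ctx_nt₁ hR hC hD'

end Constituents

/-- An induction principle that hides the individual rules: all that matters about a derivation is
that the weight of its components bounds its own weight. -/
theorem Derives.weight_induction {P : Form G.sig → Form S → Prop}
    (step : ∀ q v, q ∈ G.states → G.Derives q v →
      (∀ b, (∀ q' v', G.Component q v q' v' → P q' v' → v'.weight ≤ b) → v.weight ≤ 2 * b + 3) →
      P q v)
    {q : Form G.sig} {v : Form S} (h : G.Derives q v) (hq : q ∈ G.states) : P q v := by
  induction h with
  | @tree_terminal f us ts h ih =>
    exact step _ _ hq (.tree_terminal h) fun b hb => Form.weight_node_le fun j =>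
      hb _ _ (component_child hq h j)
        (ih j (mem_states_of_part hq (.child (S := G.sig) (f := Sum.inr f) j)))
  | tree_nt₀ hr h ih =>
    refine step _ _ hq (.tree_nt₀ hr h) fun b hb => ?_
    have := hb _ _ (component_rules₀ hr h) (ih (mem_states_of_rules₀ hr))
    omega
  | @tree_nt₁ A us R C t hR hC ht ihC iht =>
    exact step _ _ hq (.tree_nt₁ hR hC ht) fun b hb => Form.weight_fill_le
      (hb _ _ (component_tree_rules₁ hR hC ht) (ihC (mem_states_of_rules₁ hR)))
      (hb _ _ (component_argument hq hR hC ht) (iht (mem_states_of_part hq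
        (.child (S := G.sig) (f := Sum.inl (Sum.inr A)) (0 : Fin 1)))))
  | hole => exact step _ _ hq .hole fun b _ => Nat.zero_le _
  | @ctx_terminal f i us ts K C h hC ih ihC =>
    exact step _ _ hq (.ctx_terminal h hC) fun b hb => Form.weight_ctx_node_le
      (fun j => hb _ _ (component_side hq h hC j)
        (ih j (mem_states_of_part hq (.side (S := G.sig) (f := Sum.inr f) j))))
      (hb _ _ (component_spine hq h hC) (ihC (mem_states_of_part hq .spine)))
  | ctx_nt₁ hR hC hD ihC ihD =>
    exact step _ _ hq (.ctx_nt₁ hR hC hD) fun b hb => Form.weight_comp_le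
      (hb _ _ (component_ctx_rules₁ hR hC hD) (ihC (mem_states_of_rules₁ hR)))
      (hb _ _ (component_ctx_argument hq hR hC hD) (ihD (mem_states_of_part hq .spine)))

/-- The derivation of `v` from `q` stays a derivation when a piece of it is pumped, whatever tree
is in the hole of `v`. -/
def Pumpable (G : LMCFTG S) (p : ℕ) (q : Form G.sig) (v : Form S) : Prop :=
  ∀ u, ∃ C₁ C₂ C₃ C₄ t₅,
    IsPumpingDecomposition {t | ∃ w, G.Derives q w ∧ w.fill u = t} p (v.fill u) C₁ C₂ C₃ C₄ t₅

section Pumpable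

variable {p : ℕ} {q q' : Form G.sig} {v v' : Form S}

theorem Pumpable.of_contains (h : G.Contains q v q' v') (hp : G.Pumpable p q' v') :
    G.Pumpable p q v := by
  intro u
  obtain ⟨E, e, hv, hE⟩ := h.exists_surroundings
  obtain ⟨C₁, C₂, C₃, C₄, t₅, ht, hheight, hpos, hpump⟩ := hp (e u)
  refine ⟨(E u).comp C₁, C₂, C₃, C₄, t₅, ?_, hheight, hpos, fun i => ?_⟩
  · rw [hv, ht, Ctx.fill_comp]
  · obtain ⟨w', hw', hfill⟩ := hpump i
    obtain ⟨w, hw, hwE⟩ := hE w' hw'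
    exact ⟨w, hw, by rw [hwE, hfill, Ctx.fill_comp]⟩

theorem Pumpable.of_tree_recurrence {s : Tree G.sig} {t t' : Tree S}
    (h : G.Contains (.tree s) (.tree t) (.tree s) (.tree t')) (hne : t ≠ t') (hp : t.height ≤ p) :
    G.Pumpable p (.tree s) (.tree t) := by
  intro u
  obtain ⟨E, e, ht, hE⟩ := h.exists_surroundings
  have ht : t = (E u).fill t' := ht u
  have hpump (i : ℕ) :
      G.Derives (.tree s) (.tree ((pump (E u) .hole .hole i).fill t')) := by
    induction i with
    | zero => exact h.derives
    | succ i ih =>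
      obtain ⟨w, hw, hwE⟩ := hE _ ih
      obtain ⟨t'', rfl⟩ := hw.exists_eq_tree
      have : t'' = (pump (E u) .hole .hole (i + 1)).fill t' := by
        simpa only [pump, Ctx.fill_comp, Ctx.fill, Form.fill] using hwE u
      rwa [← this]
  refine ⟨.hole, E u, .hole, .hole, t', ht, ?_, ?_, fun i => ⟨_, hpump i, rfl⟩⟩
  · rw [Ctx.comp_hole, Ctx.comp_hole]
    exact (Ctx.height_le_height_fill (E u) t').trans (ht ▸ hp)
  · refine Nat.add_pos_left (Ctx.height_pos fun hole => hne ?_) _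
    rw [ht, hole, Ctx.fill]

theorem Pumpable.of_spine_recurrence {R : Ctx G.sig} {C C' : Ctx S}
    (h : G.SpineContains R C R C') (hne : C ≠ C') (hp : C.height ≤ p) :
    G.Pumpable p (.ctx R) (.ctx C) := by
  intro u
  obtain ⟨E, F, rfl, hE⟩ := h.exists_surroundings
  have hpump (i : ℕ) : G.Derives (.ctx R) (.ctx (pump E C' F i)) := by
    induction i with
    | zero => exact h.derives
    | succ i ih => exact hE _ ih
  refine ⟨.hole, E, C', F, u, ?_, hp, Nat.pos_of_ne_zero fun h₀ => hne ?_,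
    fun i => ⟨_, hpump i, rfl⟩⟩
  · simp only [Form.fill, Ctx.fill, Ctx.fill_comp]
  · have hE : E = .hole := by_contra fun hE => (Ctx.height_pos hE).ne' (by omega)
    have hF : F = .hole := by_contra fun hF => (Ctx.height_pos hF).ne' (by omega)
    rw [hE, hF, Ctx.comp_hole, Ctx.comp]

end Pumpable

section Potential

variable {q q' : Form G.sig} {v v' : Form S}

/-- The starting forms of the derivations of trees that occur in a derivation of `v` from `q`. -/
def treeForms (G : LMCFTG S) (q : Form G.sig) (v : Form S) : Set (Form G.sig) :=
  {q' | ∃ t, G.Contains q v q' (.tree t)}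

/-- The starting forms of the derivations of contexts that occur on the path to the hole in a
derivation of `v` from `q`; none if `v` is a tree. -/
def spineForms (G : LMCFTG S) : Form G.sig → Form S → Set (Form G.sig)
  | .ctx R, .ctx C => .ctx '' {R' | ∃ C', G.SpineContains R C R' C'}
  | _, _ => ∅

/-- The rank of the pair of the sizes of `treeForms` and `spineForms` in the lexicographic order.
In a derivation that cannot be pumped, it never increases from a derivation to its components, and
it stays the same only if the component has the same weight. -/
noncomputable def potential (G : LMCFTG S) (q : Form G.sig) (v : Form S) : ℕ :=
  (G.treeForms q v).ncard * (G.states.ncard + 1) + (G.spineForms q v).ncard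

theorem treeForms_subset_states : G.treeForms q v ⊆ G.states :=
  fun _ ⟨_, h⟩ => h.mem_states

theorem spineForms_subset_states : G.spineForms q v ⊆ G.states := by
  rcases q with _ | R <;> rcases v with _ | C
  · exact Set.empty_subset _
  · exact Set.empty_subset _
  · exact Set.empty_subset _
  · rintro _ ⟨_, ⟨_, h⟩, rfl⟩
    exact h.mem_states

theorem Contains.treeForms_subset (h : G.Contains q v q' v') :
    G.treeForms q' v' ⊆ G.treeForms q v :=
  fun _ ⟨t, ht⟩ => ⟨t, h.trans ht⟩

theorem SpineContains.spineForms_subset {R R' : Ctx G.sig} {C C' : Ctx S}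
    (h : G.SpineContains R C R' C') :
    G.spineForms (.ctx R') (.ctx C') ⊆ G.spineForms (.ctx R) (.ctx C) :=
  Set.image_mono fun _ ⟨D, hD⟩ => ⟨D, h.trans hD⟩

theorem potential_lt_of_treeForms_ssubset (h : G.treeForms q' v' ⊂ G.treeForms q v) :
    G.potential q' v' < G.potential q v := by
  have htree := Set.ncard_lt_ncard h (G.finite_states.subset treeForms_subset_states)
  have hspine := Set.ncard_le_ncard (spineForms_subset_states (q := q') (v := v')) G.finite_states
  have := Nat.mul_le_mul_right (G.states.ncard + 1) (Nat.succ_le_of_lt htree)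
  rw [Nat.succ_mul] at this
  unfold potential
  omega

theorem potential_lt_of_spineForms_ssubset (htree : G.treeForms q' v' ⊆ G.treeForms q v)
    (hspine : G.spineForms q' v' ⊂ G.spineForms q v) : G.potential q' v' < G.potential q v :=
  Nat.add_lt_add_of_le_of_lt
    (Nat.mul_le_mul_right _
      (Set.ncard_le_ncard htree (G.finite_states.subset treeForms_subset_states)))
    (Set.ncard_lt_ncard hspine (G.finite_states.subset spineForms_subset_states))

theorem potential_le (htree : G.treeForms q' v' ⊆ G.treeForms q v)
    (hspine : G.spineForms q' v' ⊆ G.spineForms q v) : G.potential q' v' ≤ G.potential q v :=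
  Nat.add_le_add
    (Nat.mul_le_mul_right _
      (Set.ncard_le_ncard htree (G.finite_states.subset treeForms_subset_states)))
    (Set.ncard_le_ncard hspine (G.finite_states.subset spineForms_subset_states))

theorem mem_treeForms {s : Tree G.sig} {t : Tree S} (hs : .tree s ∈ G.states)
    (h : G.Derives (.tree s) (.tree t)) : .tree s ∈ G.treeForms (.tree s) (.tree t) :=
  ⟨t, .refl hs h⟩

theorem mem_spineForms {R : Ctx G.sig} {C : Ctx S} (hR : .ctx R ∈ G.states)
    (h : G.Derives (.ctx R) (.ctx C)) : .ctx R ∈ G.spineForms (.ctx R) (.ctx C) :=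
  ⟨R, ⟨C, .refl hR h⟩, rfl⟩

theorem potential_pos (hq : q ∈ G.states) (h : G.Derives q v) : 0 < G.potential q v := by
  obtain s | R := q
  · obtain ⟨t, rfl⟩ := h.exists_eq_tree
    exact Nat.add_pos_left (Nat.mul_pos ((Set.ncard_pos
      (G.finite_states.subset treeForms_subset_states)).2 ⟨_, mem_treeForms hq h⟩)
      (Nat.succ_pos _)) _
  · obtain ⟨C, rfl⟩ := h.exists_eq_ctx
    exact Nat.add_pos_right _ ((Set.ncard_pos
      (G.finite_states.subset spineForms_subset_states)).2 ⟨_, mem_spineForms hq h⟩)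

/-- A bound on `potential` that depends on the grammar only. -/
noncomputable def potentialBound (G : LMCFTG S) : ℕ :=
  G.states.ncard * (G.states.ncard + 1) + G.states.ncard

theorem potential_le_potentialBound : G.potential q v ≤ G.potentialBound :=
  Nat.add_le_add
    (Nat.mul_le_mul_right _ (Set.ncard_le_ncard treeForms_subset_states G.finite_states))
    (Set.ncard_le_ncard spineForms_subset_states G.finite_states)

theorem Contains.potential_lt_or {p : ℕ} {s : Tree G.sig} {t : Tree S}
    (h : G.Contains (.tree s) (.tree t) q v) (hs : .tree s ∈ G.states)
    (ht : G.Derives (.tree s) (.tree t)) (hpump : ¬G.Pumpable p (.tree s) (.tree t))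
    (hp : t.height ≤ p) :
    G.potential q v < G.potential (.tree s) (.tree t) ∨
      G.potential q v ≤ G.potential (.tree s) (.tree t) ∧ (Form.tree t).weight ≤ v.weight := by
  by_cases hmem : .tree s ∈ G.treeForms q v
  · obtain ⟨t', h'⟩ := hmem
    obtain rfl : t = t' := by_contra fun hne => hpump (.of_tree_recurrence (h.trans h') hne hp)
    refine .inr ⟨potential_le h.treeForms_subset ?_, h'.weight_le⟩
    obtain t' | C := v
    · cases q <;> exact subset_rfl
    · have hle := h.weight_le
      have hge := h'.weight_le
      simp only [Form.weight] at hle hge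
      omega
  · exact .inl (potential_lt_of_treeForms_ssubset
      ⟨h.treeForms_subset, fun hsub => hmem (hsub (mem_treeForms hs ht))⟩)

theorem SpineContains.potential_lt_or {p : ℕ} {R R' : Ctx G.sig} {C C' : Ctx S}
    (h : G.SpineContains R C R' C') (hR : .ctx R ∈ G.states) (hC : G.Derives (.ctx R) (.ctx C))
    (hpump : ¬G.Pumpable p (.ctx R) (.ctx C)) (hp : C.height ≤ p) :
    G.potential (.ctx R') (.ctx C') < G.potential (.ctx R) (.ctx C) ∨
      G.potential (.ctx R') (.ctx C') ≤ G.potential (.ctx R) (.ctx C) ∧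
        (Form.ctx C).weight ≤ (Form.ctx C').weight := by
  have htree := h.contains.treeForms_subset
  by_cases hmem : .ctx R ∈ G.spineForms (.ctx R') (.ctx C')
  · obtain ⟨_, ⟨D, hD⟩, ⟨⟩⟩ := hmem
    obtain rfl : C = D := by_contra fun hne => hpump (.of_spine_recurrence (h.trans hD) hne hp)
    exact .inr ⟨potential_le htree h.spineForms_subset, hD.contains.weight_le⟩
  · exact .inl (potential_lt_of_spineForms_ssubset htree
      ⟨h.spineForms_subset, fun hsub => hmem (hsub (mem_spineForms hR hC))⟩)

theorem Component.potential_lt_or {p : ℕ} (h : G.Component q v q' v') (hq : q ∈ G.states)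
    (hv : G.Derives q v) (hpump : ¬G.Pumpable p q v) (hp : v.weight ≤ p) :
    G.potential q' v' < G.potential q v ∨
      G.potential q' v' ≤ G.potential q v ∧ v.weight ≤ v'.weight := by
  cases h with
  | of_tree h => exact h.potential_lt_or hq hv hpump (by simp only [Form.weight] at hp; omega)
  | side h =>
    exact .inl (potential_lt_of_spineForms_ssubset h.treeForms_subset
      ⟨Set.empty_subset _, fun hsub => hsub (mem_spineForms hq hv)⟩)
  | spine h => exact h.potential_lt_or hq hv hpump (by simp only [Form.weight] at hp; omega)

/- The bound `b ↦ 2 * b + 3` of `weight_induction` takes `3 * 2 ^ n - 3` to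
`3 * 2 ^ (n + 1) - 3`. -/
theorem Derives.weight_add_three_le_of_not_pumpable (h : G.Derives q v) (hq : q ∈ G.states)
    (hpump : ¬G.Pumpable (3 * 2 ^ (G.potentialBound + 1)) q v) :
    v.weight + 3 ≤ 3 * 2 ^ G.potential q v := by
  revert hpump
  refine weight_induction (P := fun q v => ¬G.Pumpable (3 * 2 ^ (G.potentialBound + 1)) q v →
    v.weight + 3 ≤ 3 * 2 ^ G.potential q v) (fun q v hq h step hpump => ?_) h hq
  have pow_mono {m n : ℕ} (hmn : m ≤ n) : 3 * 2 ^ m ≤ 3 * 2 ^ n :=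
    Nat.mul_le_mul_left 3 (Nat.pow_le_pow_right two_pos hmn)
  have weight_le {n : ℕ}
      (hn : ∀ q' v', G.Component q v q' v' → v'.weight + 3 ≤ 3 * 2 ^ G.potential q' v' →
        v'.weight + 3 ≤ 3 * 2 ^ n) : v.weight + 3 ≤ 3 * 2 ^ (n + 1) := by
    have := step (3 * 2 ^ n - 3) fun q' v' h' ih =>
      Nat.le_sub_of_add_le (hn q' v' h' (ih fun hp' => hpump (.of_contains h'.contains hp')))
    have := Nat.one_le_two_pow (n := n)
    rw [pow_succ]
    omega
  have hbound : v.weight ≤ 3 * 2 ^ (G.potentialBound + 1) :=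
    (Nat.le_add_right _ 3).trans
      (weight_le fun _ _ _ ih => ih.trans (pow_mono potential_le_potentialBound))
  by_contra! hlt
  obtain ⟨n, hn⟩ := Nat.exists_eq_succ_of_ne_zero (potential_pos hq h).ne'
  refine hlt.not_ge (hn ▸ weight_le fun q' v' h' ih => ?_)
  obtain hpotential | ⟨hpotential, hweight⟩ := h'.potential_lt_or hq h hpump hbound
  · exact ih.trans (pow_mono (Nat.le_of_lt_succ (hn ▸ hpotential)))
  · exact absurd (ih.trans (pow_mono hpotential)) (by omega)

end Potential

theorem exists_isPumpingHeight (G : LMCFTG S) : ∃ p, IsPumpingHeight G.language p := by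
  refine ⟨3 * 2 ^ (G.potentialBound + 1), fun t ht hp => ?_⟩
  have hder := mem_language_iff.1 ht
  obtain hpump | hpump := em (G.Pumpable (3 * 2 ^ (G.potentialBound + 1))
    (.tree (.nt₀ S G.N₁ G.start)) (.tree t))
  · obtain ⟨C₁, C₂, C₃, C₄, t₅, heq, hheight, hpos, hmem⟩ := hpump t
    refine ⟨C₁, C₂, C₃, C₄, t₅, heq, hheight, hpos, fun i => mem_language_iff.2 ?_⟩
    obtain ⟨w, hw, hfill⟩ := hmem i
    obtain ⟨t', rfl⟩ := hw.exists_eq_tree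
    rwa [← hfill]
  · have hweight := hder.weight_add_three_le_of_not_pumpable start_mem_states hpump
    have hpotential : 3 * 2 ^ G.potential (.tree (.nt₀ S G.N₁ G.start)) (.tree t) ≤
        3 * 2 ^ (G.potentialBound + 1) := Nat.mul_le_mul_left 3
      (Nat.pow_le_pow_right two_pos (potential_le_potentialBound.trans (Nat.le_succ _)))
    simp only [Form.weight] at hweight
    omega

end LMCFTG

end CrossSerial

theorem lemma9_general {S : Signature} [Finite S.Sym] (lex : S.Sym → Option Token) (G : LMCFTG S)
    {k : ℕ} {L : Type} (h : HRHom S k L) (hCSD : Prod.fst '' REL G lex h ⊆ CSDStrings) :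
    (∃ p : ℕ, IsPumpingHeight G.language p) ∧
    ∀ p : ℕ, IsPumpingHeight G.language p →
      ∃ l₀ : ℕ, IsGreatest (generatedSizes lex h p) l₀ ∧
        ∀ t ∈ G.language, IsSeparated lex .a .c l₀ t ∨ IsSeparated lex .d .b l₀ t := by
  refine ⟨G.exists_isPumpingHeight, fun p hp => ?_⟩
  obtain ⟨l₀, hl₀⟩ := exists_isGreatest_generatedSizes lex h p
  refine ⟨l₀, hl₀, fun t => hp.isSeparated (fun t ht => ?_) fun C hC => hl₀.2 ⟨C, hC, .inl rfl⟩⟩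
  exact hCSD ⟨(_, (h.tree t).eval), ⟨t, ht, rfl, Equiv.refl _, by simp, by simp⟩, rfl⟩

theorem lemma9 (S : Signature) (hS : Finite S.Sym) (lex : S.Sym → Option Token)
    (G : LMCFTG S) (k : ℕ) (L : Type) (h : HRHom S k L)
    (hCSD : Prod.fst '' REL G lex h = CSDStrings) :
    (∃ p : ℕ, IsPumpingHeight G.language p) ∧
    ∀ p : ℕ, IsPumpingHeight G.language p →
      ∃ l₀ : ℕ, IsGreatest (generatedSizes lex h p) l₀ ∧
        ∀ t ∈ G.language, ∃ xy ∈ SepPairs, IsSeparated lex xy.1 xy.2 l₀ t := by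
  refine (lemma9_general lex G h hCSD.subset).imp_right fun hsep p hp => ?_
  exact (hsep p hp).imp fun l₀ => And.imp_right fun hl₀ t ht => (hl₀ t ht).elim
    (fun hac => ⟨(.a, .c), .inl rfl, hac⟩) fun hdb => ⟨(.d, .b), .inr (.inr (.inr rfl)), hdb⟩
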